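/- Let $a:[0,1]\times[0,2\pi]\to\mathbb C$, and for $k\in\mathbb Z$, $x\in[0,1]$ let $\hat a_k(x)=\frac1{2\pi}\int_0^{2\pi}a(x,t)e^{-ikt}\,dt$. For $n\ge 0$ let $T_n(a)$ be the $(n+1)\times(n+1)$ matrix $$T_n(a)=\Big[\hat a_{j-i}\Big(\frac{i+j}{2n+2}\Big)\Big]_{i,j=0}^n .$$ Write $\|f\|_\infty=\sup_{[0,1]}|f|$ and $\|a\|_{\ast}=\sum_{k\in\mathbb Z}\|\hat a_k\|_\infty$. Let $0<\alpha\le 1$, and suppose that $a(x,\cdot)\in C^{1+\alpha}([0,2\pi])$ for every $x\in[0,1]$ and $a(\cdot,t)\in C^{1+\alpha}([0,1])$ for every $t\in[0,2\pi]$ (continuously differentiable with $\alpha$-Hölder derivative), that every $\hat a_k$ is continuously differentiable on $[0,1]$, and that $$\sum_{k\in\mathbb Z}|k|^{1+1/\alpha}\,\|\hat a_k\|_\infty<\infty\qquad\text{and}\qquad\sum_{k\in\mathbb Z}\|\partial_x\hat a_k\|_\infty<\infty .$$ Then, for every $p\in\mathbb N=\{0,1,2,\dots\}$, as $n\to\infty$,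 $$\begin{aligned}\operatorname{Tr}[T_n(a)^p]&=\frac{n+1}{2\pi}\int_0^1\!\int_0^{2\pi}a(x,t)^p\,dt\,dx+\frac1{4\pi}\int_0^{2\pi}a(0,t)^p\,dt-\frac1{4\pi}\int_0^{2\pi}a(1,t)^p\,dt\\&\quad-\sum_{\substack{h\in\mathbb Z^p\\ h_1+\cdots+h_p=0}}N(h)\Big[\prod_{j=1}^p\hat a_{h_j}(0)+\prod_{j=1}^p\hat a_{h_j}(1)\Big]+p\,\|a\|_{\ast}^{p-1}\,o(1),\end{aligned}$$ where $N(h)=\max\{0,h_1,h_1+h_2,\dots,h_1+\cdots+h_{p-1}\}$, the series over $h$ converges absolutely, and for each fixed $p$ the term $o(1)$ tends to $0$ as $n\to\infty$ (for $p=0$ the last two terms are $0$). -/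

import Mathlib

open Set Filter Topology MeasureTheory
open scoped NNReal BigOperators

noncomputable section

namespace KMS

/-- The `k`-th Fourier coefficient `x ↦ (1/2π) ∫₀^{2π} a(x,t) e^{-ikt} dt` of the symbol `a`. -/
def coeff (a : ℝ → ℝ → ℂ) (k : ℤ) (x : ℝ) : ℂ :=
  fourierCoeffOn Real.two_pi_pos (a x) k

/-- The matrix `T_n(a)`, with entries `â_{j-i}((i+j)/(2n+2))` for `0 ≤ i, j ≤ n`. -/
def T (a : ℝ → ℝ → ℂ) (n : ℕ) : Matrix (Fin (n + 1)) (Fin (n + 1)) ℂ :=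
  Matrix.of fun i j =>
    coeff a (((j : ℕ) : ℤ) - ((i : ℕ) : ℤ))
      ((((i : ℕ) : ℝ) + ((j : ℕ) : ℝ)) / (2 * (n : ℝ) + 2))

/-- The sup norm on `[0,1]`. -/
def supNorm (f : ℝ → ℂ) : ℝ := ⨆ x : Icc (0 : ℝ) 1, ‖f x‖

/-- `∑_k ‖â_k‖_∞`. -/
def tripleNorm (a : ℝ → ℝ → ℂ) : ℝ := ∑' k : ℤ, supNorm (coeff a k)

/-- `f ∈ C^{1+α}([u,v])`: continuously differentiable on `[u,v]` with `α`-Hölder derivative. -/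
def C1Holder (α : ℝ≥0) (f : ℝ → ℂ) (u v : ℝ) : Prop :=
  ContDiffOn ℝ 1 f (Icc u v) ∧
    ∃ C : ℝ≥0, HolderOnWith C α (derivWithin f (Icc u v)) (Icc u v)

/-- `N(h) = max {0, h₁, h₁+h₂, …, h₁+⋯+h_{p-1}}`. The term at `m` is the sum of the entries
before `m`, truncated at `0`; this does not change the maximum, since `0` belongs to the set. -/
def N {p : ℕ} (h : Fin p → ℤ) : ℕ :=
  Finset.univ.sup fun m : Fin p => (∑ j ∈ Finset.Iio m, h j).toNat

/-- The summand `N(h) (∏_j â_{h_j}(0) + ∏_j â_{h_j}(1))`. -/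
def edgeTerm (a : ℝ → ℝ → ℂ) {p : ℕ} (h : Fin p → ℤ) : ℂ :=
  (N h : ℂ) * ((∏ j, coeff a (h j) 0) + ∏ j, coeff a (h j) 1)

end KMS

end

noncomputable section

namespace KMS

/-! The trace of `T_n(a)^p` is a sum over closed lattice paths: a start `i` and a zero-sum tuple of
steps `h`. Such a path stays in `[0, n]` exactly when `N(-h) ≤ i ≤ n - N(h)`, and its weight is a
product of coefficients at the shifted points `(i + μ_j)/(n+1)`, where `μ_j` is `midpoint h j`. The
absolutely convergent Fourier series of `a(x, ·)` likewise writes the leading integral as a series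
over the same tuples. The claim therefore reduces to a limit for each `h` and an interchange of
limit and sum.

Fix `h` and put `F = ∏ â_{h_j}`. Comparing the full Riemann sum with the integral gives `(F(0) -
F(1))/2`; the missing starts give `-N(-h) F(0) - N(h) F(1)`; the shifts `μ_j` give a further
first-order term. Reversing `h` preserves `F`, swaps `N(h)` and `N(-h)`, and negates the shifts up
to reordering. Adding the two contributions thus cancels the shift term and leaves the symmetric
edge term (`tendsto_remainder_add_rev`). Reversal permutes the zero-sum tuples, so this
symmetrization only doubles the sum.

The interchange is dominated convergence: `norm_remainder_le` bounds each remainder, uniformly in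
`n`, by `(p + 2) ∏ weight(h_j)`, a summable product. -/

/-! ### Multiple series over integer tuples -/

theorem hasSum_of_forall_eq {ι R : Type*} [AddCommMonoid R] [TopologicalSpace R] {f g : ι → R}
    {s : R} (hf : HasSum f s) (h : ∀ x, g x = f x) : HasSum g s := by
  rwa [show g = f from funext h]

/-- A series whose terms vanish off the zero-sum tuples is a series over zero-sum tuples. -/
theorem hasSum_zeroSum {p : ℕ} {f : (Fin p → ℤ) → ℂ} {s : ℂ}
    (hs : HasSum (fun h => if ∑ j, h j = 0 then f h else 0) s) :
    HasSum (fun h : {h : Fin p → ℤ // ∑ j, h j = 0} => f h.1) s := by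
  have h1 := (Subtype.val_injective (p := fun h : Fin p → ℤ => ∑ j, h j = 0)).hasSum_iff
    (f := fun h => if ∑ j, h j = 0 then f h else 0) (a := s) fun h hh => by
      rw [if_neg]
      intro h0
      exact hh ⟨⟨h, h0⟩, rfl⟩
  refine hasSum_of_forall_eq (h1.2 hs) fun h => ?_
  simp [h.2]

/-- A multiple series of products of absolutely summable factors converges absolutely, and its sum
is a power of the sum of the factors. -/
theorem hasSum_prod_pow {R ι : Type*} [NormedCommRing R] [NormOneClass R] [CompleteSpace R]
    {f : ι → R} (hf : Summable fun k => ‖f k‖) (p : ℕ) :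
    (Summable fun h : Fin p → ι => ‖∏ j, f (h j)‖) ∧
      HasSum (fun h : Fin p → ι => ∏ j, f (h j)) ((∑' k, f k) ^ p) := by
  induction p with
  | zero =>
    refine ⟨(hasSum_fintype _).summable, ?_⟩
    simp
  | succ p ih =>
    have h1 := hf.mul_norm ih.1
    have h2 := tsum_mul_tsum_of_summable_norm hf ih.1
    rw [ih.2.tsum_eq, ← pow_succ'] at h2
    have h3 := h1.of_norm.hasSum
    rw [← h2] at h3
    constructor
    · rw [← (Fin.consEquiv fun _ => ι).summable_iff]
      refine h1.congr fun x => ?_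
      simp [Fin.consEquiv, Fin.prod_univ_succ]
    · rw [← (Fin.consEquiv fun _ => ι).hasSum_iff]
      refine hasSum_of_forall_eq h3 fun x => ?_
      simp [Fin.consEquiv, Fin.prod_univ_succ]

/-! ### Partial sums, reversal and the quantity `N` -/

/-- The sum of the first `m` entries of `h`. -/
def partialSum {p : ℕ} (h : Fin p → ℤ) (m : ℕ) : ℤ := ∑ j : Fin p, if (j : ℕ) < m then h j else 0

theorem partialSum_zero {p : ℕ} (h : Fin p → ℤ) : partialSum h 0 = 0 := by simp [partialSum]

theorem partialSum_length {p : ℕ} (h : Fin p → ℤ) : partialSum h p = ∑ j, h j := by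
  simp [partialSum]

theorem partialSum_succ {p : ℕ} (h : Fin p → ℤ) (j : Fin p) :
    partialSum h (j + 1) = partialSum h j + h j := by
  have : h j = ∑ l : Fin p, if l = j then h l else 0 := by simp
  rw [this, partialSum, partialSum, ← Finset.sum_add_distrib]
  refine Finset.sum_congr rfl fun l _ => ?_
  rcases lt_trichotomy l j with hl | rfl | hl
  · have : (l : ℕ) < j := hl
    simp [hl.ne, this, this.trans (Nat.lt_succ_self _)]
  · simp
  · have : (j : ℕ) < l := hl
    rw [if_neg (by omega), if_neg (by omega), if_neg hl.ne', add_zero]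

theorem partialSum_cons {p : ℕ} (k : ℤ) (h : Fin p → ℤ) (m : ℕ) :
    partialSum (Fin.cons k h : Fin (p + 1) → ℤ) (m + 1) = k + partialSum h m := by
  simp [partialSum, Fin.sum_univ_succ]

theorem partialSum_neg {p : ℕ} (h : Fin p → ℤ) (m : ℕ) :
    partialSum (-h) m = -partialSum h m := by
  rw [partialSum, partialSum, ← Finset.sum_neg_distrib]
  refine Finset.sum_congr rfl fun l _ => ?_
  split_ifs <;> simp

/-- The first `m` reversed entries are the last `m` entries, which complement the first `p - m` in a
vanishing total. -/
theorem partialSum_rev {p : ℕ} {h : Fin p → ℤ} (hh : ∑ j, h j = 0) {m : ℕ} (hm : m ≤ p) :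
    partialSum (h ∘ Fin.rev) m = -partialSum h (p - m) := by
  rw [eq_neg_iff_add_eq_zero, ← hh, partialSum, ← Equiv.sum_comp Fin.revPerm, partialSum,
    ← Finset.sum_add_distrib]
  refine Finset.sum_congr rfl fun l _ => ?_
  have := l.2
  by_cases h1 : (l : ℕ) < p - m
  · have h2 : ¬ p - (l + 1) < m := by omega
    simp [h1, h2, Fin.val_rev]
  · have h2 : p - (l + 1) < m := by omega
    simp [h1, h2, Fin.val_rev]

theorem N_eq_sup_partialSum {p : ℕ} (h : Fin p → ℤ) :
    N h = Finset.univ.sup fun m : Fin p => (partialSum h m).toNat := by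
  unfold N
  congr 1
  funext m
  rw [partialSum, ← Finset.sum_filter]
  congr 2
  ext l
  simp

theorem partialSum_le_N {p : ℕ} {h : Fin p → ℤ} (hh : ∑ j, h j = 0) {m : ℕ} (hm : m ≤ p) :
    partialSum h m ≤ N h := by
  rcases hm.lt_or_eq with hm | rfl
  · rw [N_eq_sup_partialSum]
    have := Finset.le_sup (f := fun m : Fin p => (partialSum h m).toNat) (Finset.mem_univ ⟨m, hm⟩)
    dsimp only at this
    omega
  · rw [partialSum_length, hh]
    positivity

/-- Zero sum allows `m = p` to be included, which makes the range of `m` invariant under `m ↦ p -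
m`, as reversal requires. -/
theorem N_le_iff {p : ℕ} {h : Fin p → ℤ} (hh : ∑ j, h j = 0) {c : ℕ} :
    N h ≤ c ↔ ∀ m ≤ p, partialSum h m ≤ c := by
  constructor
  · intro hc m hm
    have := partialSum_le_N hh hm
    omega
  · intro hc
    rw [N_eq_sup_partialSum, Finset.sup_le_iff]
    intro m _
    have := hc m m.2.le
    omega

theorem sum_rev {p : ℕ} (h : Fin p → ℤ) : ∑ j, (h ∘ Fin.rev) j = ∑ j, h j :=
  Equiv.sum_comp Fin.revPerm h

theorem N_rev {p : ℕ} {h : Fin p → ℤ} (hh : ∑ j, h j = 0) : N (h ∘ Fin.rev) = N (-h) := by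
  refine eq_of_forall_ge_iff fun c => ?_
  rw [N_le_iff (by rw [sum_rev, hh]), N_le_iff (by simp [hh])]
  constructor
  · intro hc m hm
    have := hc (p - m) (Nat.sub_le _ _)
    rw [partialSum_rev hh (Nat.sub_le _ _), Nat.sub_sub_self hm] at this
    rwa [partialSum_neg]
  · intro hc m hm
    have := hc (p - m) (Nat.sub_le _ _)
    rw [partialSum_neg] at this
    rwa [partialSum_rev hh hm]

/-- The partial sums shifted by `i` stay in `[0, n]` exactly if `i` keeps the appropriate distance
from the end points. -/
theorem forall_partialSum_mem_iff {p : ℕ} {h : Fin p → ℤ} (hh : ∑ j, h j = 0) (i n : ℕ) :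
    (∀ m ≤ p, 0 ≤ i + partialSum h m ∧ i + partialSum h m ≤ n) ↔ N (-h) ≤ i ∧ i + N h ≤ n := by
  have h1 : ∑ j, (-h) j = 0 := by simp [hh]
  constructor
  · intro H
    refine ⟨(N_le_iff h1).2 fun m hm => ?_, ?_⟩
    · rw [partialSum_neg]; linarith [(H m hm).1]
    · have h0 := H 0 (Nat.zero_le _)
      rw [partialSum_zero] at h0
      have : N h ≤ n - i := (N_le_iff hh).2 fun m hm => by have := (H m hm).2; omega
      omega
  · rintro ⟨H1, H2⟩ m hm
    have h2 := partialSum_le_N hh hm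
    have h3 := partialSum_le_N h1 hm
    rw [partialSum_neg] at h3
    omega

/-- The freedom in `S` is used to leave out one chosen step. -/
theorem abs_partialSum_le {p : ℕ} (h : Fin p → ℤ) (m : ℕ) (S : Finset (Fin p))
    (hS : ∀ l : Fin p, (l : ℕ) < m → l ∈ S) : |partialSum h m| ≤ ∑ l ∈ S, |h l| := by
  rw [partialSum, ← Finset.sum_filter]
  refine (Finset.abs_sum_le_sum_abs _ _).trans
    (Finset.sum_le_sum_of_subset_of_nonneg ?_ fun _ _ _ => abs_nonneg _)
  intro l hl
  exact hS l (Finset.mem_filter.1 hl).2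

theorem N_le_sum_abs {p : ℕ} {h : Fin p → ℤ} (hh : ∑ j, h j = 0) : (N h : ℤ) ≤ ∑ l, |h l| := by
  have h0 : 0 ≤ ∑ l, |h l| := Finset.sum_nonneg fun _ _ => abs_nonneg _
  lift ∑ l, |h l| to ℕ using h0 with c hc
  rw [Nat.cast_le, N_le_iff hh, hc]
  exact fun m _ => (le_abs_self _).trans
    (abs_partialSum_le h m _ fun _ _ => Finset.mem_univ _)

/-- For a closed path, the partial sums before and after the step `j` are controlled by the other
steps. -/
theorem abs_partialSum_add_le {p : ℕ} {h : Fin p → ℤ} (hh : ∑ j, h j = 0) (j : Fin p) :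
    |partialSum h j + partialSum h (j + 1)| ≤ 2 * ∑ l ∈ Finset.univ.erase j, |h l| := by
  have h1 : |partialSum h j| ≤ ∑ l ∈ Finset.univ.erase j, |h l| :=
    abs_partialSum_le h j _ fun l hl => by
      simp only [Finset.mem_erase, Finset.mem_univ, and_true]
      rintro rfl
      exact lt_irrefl _ hl
  have h2 : |partialSum h (j + 1)| ≤ ∑ l ∈ Finset.univ.erase j, |h l| := by
    have hj := j.2
    -- The position after step `j` is minus the sum of the later steps, hence a partial sum of the
    -- reversed tuple that does not contain `h j`.
    have h3 := partialSum_rev hh (m := p - (j + 1)) (Nat.sub_le _ _)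
    rw [Nat.sub_sub_self (by omega)] at h3
    rw [← abs_neg, ← h3]
    have h4 := abs_partialSum_le (h ∘ Fin.rev) (p - (j + 1)) (Finset.univ.erase j.rev) fun l hl => by
      simp only [Finset.mem_erase, Finset.mem_univ, and_true]
      rintro rfl
      simp [Fin.val_rev] at hl
    refine h4.trans_eq ?_
    refine Finset.sum_bij (fun l _ => l.rev) ?_ ?_ ?_ ?_
    · intro l hl
      simp only [Finset.mem_erase, Finset.mem_univ, and_true, ne_eq] at hl ⊢
      rwa [Fin.rev_eq_iff]
    · intro a _ b _ hab
      exact Fin.rev_injective hab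
    · intro b hb
      refine ⟨b.rev, ?_, Fin.rev_rev b⟩
      simpa using hb
    · intro l _
      rfl
  exact (abs_add_le _ _).trans (by linarith)

/-! ### Matrix powers and traces as sums over paths -/

/-- The entries of a matrix, extended by zero to integer indices. -/
def intEntry {n : ℕ} (M : Matrix (Fin (n + 1)) (Fin (n + 1)) ℂ) (u v : ℤ) : ℂ :=
  if (0 ≤ u ∧ u ≤ n) ∧ 0 ≤ v ∧ v ≤ n then M (Fin.ofNat (n + 1) u.toNat) (Fin.ofNat (n + 1) v.toNat)
  else 0

theorem intEntry_coe {n : ℕ} (M : Matrix (Fin (n + 1)) (Fin (n + 1)) ℂ) (i j : Fin (n + 1)) :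
    intEntry M (i : ℕ) (j : ℕ) = M i j := by
  have hi := i.2
  have hj := j.2
  rw [intEntry, if_pos (by omega)]
  simp [Fin.ofNat, Nat.mod_eq_of_lt hi, Nat.mod_eq_of_lt hj]

/-- The weight of the path that starts at `i` and has steps `h`. -/
def pathWeight {n p : ℕ} (M : Matrix (Fin (n + 1)) (Fin (n + 1)) ℂ) (i : ℤ) (h : Fin p → ℤ) : ℂ :=
  ∏ j : Fin p, intEntry M (i + partialSum h j) (i + partialSum h (j + 1))

theorem pathWeight_cons {n p : ℕ} (M : Matrix (Fin (n + 1)) (Fin (n + 1)) ℂ) (i k : ℤ)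
    (h : Fin p → ℤ) :
    pathWeight M i (Fin.cons k h : Fin (p + 1) → ℤ) =
      intEntry M i (i + k) * pathWeight M (i + k) h := by
  rw [pathWeight, Fin.prod_univ_succ, pathWeight]
  simp only [Fin.val_succ, Fin.val_zero, partialSum_cons, partialSum_zero, add_zero, ← add_assoc]

/-- The entries of a matrix power as sums over paths. -/
theorem hasSum_pathWeight {n : ℕ} (M : Matrix (Fin (n + 1)) (Fin (n + 1)) ℂ) (p : ℕ)
    (i k : Fin (n + 1)) :
    HasSum (fun h : Fin p → ℤ =>
      if (i : ℕ) + ∑ j, h j = ((k : ℕ) : ℤ) then pathWeight M (i : ℕ) h else 0) ((M ^ p) i k) := by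
  induction p generalizing i with
  | zero =>
    have := hasSum_fintype fun h : Fin 0 → ℤ =>
      if (i : ℕ) + ∑ j, h j = ((k : ℕ) : ℤ) then pathWeight M (i : ℕ) h else 0
    convert this using 1
    simp [pathWeight, Matrix.one_apply, Fin.ext_iff]
  | succ p ih =>
    rw [pow_succ', Matrix.mul_apply]
    -- The intermediate index `l` of the matrix product fixes the first step as `l - i`; the
    -- remaining steps form a path from `l`.
    have key : ∀ l : Fin (n + 1), HasSum (fun h : Fin (p + 1) → ℤ =>
        if h 0 = (l : ℕ) - ((i : ℕ) : ℤ) then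
          M i l * (if (l : ℕ) + ∑ j, Fin.tail h j = ((k : ℕ) : ℤ) then
            pathWeight M (l : ℕ) (Fin.tail h) else 0) else 0) (M i l * (M ^ p) l k) := by
      intro l
      have hinj : Function.Injective fun h : Fin p → ℤ =>
          (Fin.cons ((l : ℕ) - ((i : ℕ) : ℤ)) h : Fin (p + 1) → ℤ) :=
        fun a b hab => Fin.cons_right_injective _ hab
      rw [← hinj.hasSum_iff]
      · refine hasSum_of_forall_eq ((ih l).mul_left (M i l)) fun h => ?_
        simp
      · intro h hh
        rw [if_neg]
        intro h0
        exact hh ⟨Fin.tail h, by simp only; rw [← h0, Fin.cons_self_tail]⟩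
    have hs := hasSum_sum fun l (_ : l ∈ Finset.univ) => key l
    convert hs using 2 with h
    obtain ⟨k₀, h, rfl⟩ : ∃ k₀ h', h = (Fin.cons k₀ h' : Fin (p + 1) → ℤ) :=
      ⟨h 0, Fin.tail h, (Fin.cons_self_tail h).symm⟩
    rw [Fin.sum_univ_succ, pathWeight_cons]
    simp only [Fin.cons_zero, Fin.tail_cons, Fin.cons_succ]
    -- A first step landing in `[0, n]` selects exactly one `l`; any other is killed by the
    -- extension by zero.
    by_cases hk : 0 ≤ (i : ℕ) + k₀ ∧ (i : ℕ) + k₀ ≤ n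
    · have hl : ((i : ℕ) + k₀).toNat < n + 1 := by omega
      rw [Finset.sum_eq_single (⟨((i : ℕ) + k₀).toNat, hl⟩ : Fin (n + 1))]
      · have e : ((((i : ℕ) + k₀).toNat : ℕ) : ℤ) = (i : ℕ) + k₀ := by omega
        have e2 := intEntry_coe M i ⟨((i : ℕ) + k₀).toNat, hl⟩
        simp only [e] at e2 ⊢
        rw [if_pos (show k₀ = (i : ℕ) + k₀ - (i : ℕ) by ring), ← e2, add_assoc, mul_ite, mul_zero]
      · intro l _ hne
        rw [if_neg]
        intro h0
        apply hne
        ext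
        simp only
        omega
      · simp
    · have h0 : intEntry M (i : ℕ) ((i : ℕ) + k₀) = 0 := if_neg fun h => hk h.2
      rw [h0, zero_mul, ite_self, Finset.sum_eq_zero]
      intro l _
      have := l.2
      rw [if_neg (by omega)]

/-- The trace of a matrix power as a sum over closed paths. -/
theorem hasSum_trace_pow {n : ℕ} (M : Matrix (Fin (n + 1)) (Fin (n + 1)) ℂ) (p : ℕ) :
    HasSum (fun h : {h : Fin p → ℤ // ∑ j, h j = 0} =>
      ∑ i ∈ Finset.range (n + 1), pathWeight M (i : ℕ) h.1) (M ^ p).trace := by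
  have hs : HasSum (fun h : Fin p → ℤ => ∑ i : Fin (n + 1),
      if (i : ℕ) + ∑ j, h j = ((i : ℕ) : ℤ) then pathWeight M (i : ℕ) h else 0) (M ^ p).trace := by
    rw [Matrix.trace]
    exact hasSum_sum fun i _ => hasSum_pathWeight M p i i
  refine hasSum_zeroSum (f := fun h => ∑ i ∈ Finset.range (n + 1), pathWeight M (i : ℕ) h)
    (hasSum_of_forall_eq hs fun h => ?_)
  rw [Finset.sum_range]
  by_cases h0 : ∑ j, h j = 0
  · simp [h0]
  · simp [h0]

/-! ### Means of powers of Fourier series -/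

/-- A square integrable function on the circle with absolutely summable Fourier coefficients agrees
almost everywhere with its Fourier series. -/
theorem ae_eq_tsum_fourier {T : ℝ} [hT : Fact (0 < T)] {f : AddCircle T → ℂ}
    (hf : MemLp f 2 AddCircle.haarAddCircle) (hs : Summable fun k => ‖fourierCoeff f k‖) :
    f =ᵐ[AddCircle.haarAddCircle] fun x => ∑' k, fourierCoeff f k * fourier k x := by
  have hsum : Summable fun k => fourierCoeff f k • (fourier k : C(AddCircle T, ℂ)) := by
    refine .of_norm ?_
    simpa only [norm_smul, fourier_norm, mul_one] using hs
  set g : C(AddCircle T, ℂ) := ∑' k, fourierCoeff f k • fourier k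
  have h1 := (ContinuousMap.toLp (E := ℂ) 2 AddCircle.haarAddCircle ℂ).hasSum hsum.hasSum
  -- The uniform limit `g` and the class of `f` are sums of the same series in `L²`, hence equal
  -- there.
  have h2 := hasSum_fourier_series_L2 (hf.toLp f)
  have h3 : (fun k => fourierCoeff (hf.toLp f) k • fourierLp (T := T) 2 k) =
      fun k => ContinuousMap.toLp (E := ℂ) 2 AddCircle.haarAddCircle ℂ
        (fourierCoeff f k • fourier k) := by
    funext k
    rw [fourierCoeff_congr_ae hf.coeFn_toLp, map_smul]
  rw [h3] at h2
  have h4 : hf.toLp f = ContinuousMap.toLp (E := ℂ) 2 AddCircle.haarAddCircle ℂ g := h2.unique h1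
  have h5 := ContinuousMap.coeFn_toLp (E := ℂ) (p := 2) (𝕜 := ℂ) AddCircle.haarAddCircle g
  rw [← h4] at h5
  refine hf.coeFn_toLp.symm.trans (h5.trans (Eventually.of_forall fun x => ?_))
  have h6 := (ContinuousMap.evalCLM ℂ x).hasSum hsum.hasSum
  exact h6.tsum_eq.symm

/-- The mean of the `p`-th power of an absolutely convergent Fourier series. -/
theorem hasSum_integral_fourier_pow {T : ℝ} [hT : Fact (0 < T)] {c : ℤ → ℂ}
    (hc : Summable fun k => ‖c k‖) (p : ℕ) :
    HasSum (fun h : {h : Fin p → ℤ // ∑ j, h j = 0} => ∏ j, c (h.1 j))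
      (∫ x : AddCircle T, (∑' k, c k * fourier k x) ^ p ∂AddCircle.haarAddCircle) := by
  have hx : ∀ (x : AddCircle T) (k : ℤ), ‖c k * fourier k x‖ = ‖c k‖ := fun x k => by
    rw [norm_mul, fourier_apply, Circle.norm_coe, mul_one]
  have hfp : ∀ (x : AddCircle T) (h : Fin p → ℤ),
      ∏ j, c (h j) * fourier (h j) x = (∏ j, c (h j)) * fourier (∑ j, h j) x := by
    intro x h
    rw [Finset.prod_mul_distrib]
    congr 1
    induction (Finset.univ : Finset (Fin p)) using Finset.induction_on with
    | empty => simp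
    | insert a s ha ih => rw [Finset.prod_insert ha, Finset.sum_insert ha, ih, fourier_add]
  have hbound : ∀ h : Fin p → ℤ, ∀ x : AddCircle T,
      ‖(∏ j, c (h j)) * fourier (∑ j, h j) x‖ ≤ ∏ j, ‖c (h j)‖ := by
    intro h x
    rw [norm_mul, fourier_apply, Circle.norm_coe, mul_one, norm_prod]
  have hsumb : Summable fun h : Fin p → ℤ => ∏ j, ‖c (h j)‖ := by
    simpa only [norm_prod] using (hasSum_prod_pow hc p).1
  have h1 : HasSum (fun h : Fin p → ℤ => ∫ x : AddCircle T,
      (∏ j, c (h j)) * fourier (∑ j, h j) x ∂AddCircle.haarAddCircle)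
      (∫ x : AddCircle T, (∑' k, c k * fourier k x) ^ p ∂AddCircle.haarAddCircle) := by
    refine hasSum_integral_of_dominated_convergence (fun h _ => ∏ j, ‖c (h j)‖) ?_ ?_ ?_ ?_ ?_
    · intro h
      exact (continuous_const.mul (map_continuous _)).aestronglyMeasurable
    · exact fun h => Eventually.of_forall fun x => hbound h x
    · exact Eventually.of_forall fun x => hsumb
    · exact integrable_const _
    · refine Eventually.of_forall fun x => ?_
      have h2 := (hasSum_prod_pow (f := fun k => c k * fourier k x)
        (by simpa only [hx] using hc) p).2
      exact hasSum_of_forall_eq h2 fun h => (hfp x h).symm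
  refine hasSum_zeroSum (f := fun h => ∏ j, c (h j)) (hasSum_of_forall_eq h1 fun h => ?_)
  rw [integral_const_mul]
  have h3 := congrFun (fourierCoeff_fourier (T := T) (∑ j, h j)) 0
  simp only [fourierCoeff, neg_zero, fourier_zero, one_smul] at h3
  rw [h3, Pi.single_apply]
  by_cases h0 : ∑ j, h j = 0
  · simp [h0]
  · simp [h0, Ne.symm h0]

/-- The integral of the `p`-th power of a function with absolutely summable Fourier coefficients. -/
theorem hasSum_intervalIntegral_pow {a b : ℝ} (hab : a < b) {f : ℝ → ℂ}
    (hf : ContinuousOn f (Icc a b)) (hs : Summable fun k => ‖fourierCoeffOn hab f k‖) (p : ℕ) :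
    HasSum (fun h : {h : Fin p → ℤ // ∑ j, h j = 0} =>
      ((b - a : ℝ) : ℂ) * ∏ j, fourierCoeffOn hab f (h.1 j)) (∫ t in a..b, f t ^ p) := by
  have hT := Fact.mk (by linarith : 0 < b - a)
  have hL : MemLp f 2 (volume.restrict (Ioc a (a + (b - a)))) := by
    rw [add_sub_cancel]
    obtain ⟨C, hC⟩ := isCompact_Icc.exists_bound_of_continuousOn hf
    refine MemLp.of_bound ?_ C ?_
    · exact (hf.mono Ioc_subset_Icc_self).aestronglyMeasurable measurableSet_Ioc
    · exact (ae_restrict_mem measurableSet_Ioc).mono fun x hx => hC x (Ioc_subset_Icc_self hx)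
  have hL2 := hL.memLp_liftIoc.haarAddCircle
  -- Since `f a = f b` is not assumed, the periodic lift may jump; almost everywhere equality
  -- suffices for the integral.
  have h1 := ae_eq_tsum_fourier hL2 hs
  have h2 := hasSum_integral_fourier_pow (T := b - a) hs p
  have h3 : ∫ t in a..b, f t ^ p = ((b - a : ℝ) : ℂ) * ∫ x : AddCircle (b - a),
      (∑' k, fourierCoeffOn hab f k * fourier k x) ^ p ∂AddCircle.haarAddCircle := by
    have h4 : ∫ t in a..b, f t ^ p =
        ∫ x, AddCircle.liftIoc (b - a) a (fun t => f t ^ p) x := by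
      rw [AddCircle.integral_liftIoc_eq_intervalIntegral, add_sub_cancel]
    have h5 : ∫ x, AddCircle.liftIoc (b - a) a (fun t => f t ^ p) x = (b - a) •
        ∫ x, AddCircle.liftIoc (b - a) a (fun t => f t ^ p) x ∂AddCircle.haarAddCircle := by
      rw [AddCircle.integral_haarAddCircle, smul_inv_smul₀ hT.out.ne']
    rw [h4, h5, Complex.real_smul]
    congr 1
    refine integral_congr_ae (h1.mono fun x hx => ?_)
    dsimp only at hx ⊢
    rw [show fourierCoeffOn hab f = fourierCoeff (AddCircle.liftIoc (b - a) a f) from rfl, ← hx]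
    rfl
  rw [h3]
  exact h2.mul_left _

/-! ### Riemann sum asymptotics -/

/-- A continuously differentiable function has a first-order Taylor expansion uniformly on
compact sets. -/
theorem exists_uniform_taylor {E : Type*} [NormedAddCommGroup E] [NormedSpace ℝ E] {G : E → ℂ}
    (hG : ContDiff ℝ 1 G) {K : Set E} (hK : IsCompact K) {η : ℝ} (hη : 0 < η) :
    ∃ δ > 0, ∀ x ∈ K, ∀ v, ‖v‖ < δ → ‖G (x + v) - G x - fderiv ℝ G x v‖ ≤ η * ‖v‖ := by
  have hc : Continuous (fderiv ℝ G) := hG.continuous_fderiv one_ne_zero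
  have hu := hK.uniformContinuousAt_of_continuousAt (fderiv ℝ G)
    (fun a _ => hc.continuousAt) (Metric.dist_mem_uniformity hη)
  obtain ⟨δ, hδ, h⟩ := Metric.mem_uniformity_dist.1 hu
  refine ⟨δ, hδ, fun x hx v hv => ?_⟩
  have h1 := (convex_ball x δ).norm_image_sub_le_of_norm_fderiv_le' (𝕜 := ℝ) (f := G)
    (φ := fderiv ℝ G x) (C := η) (x := x) (y := x + v)
    (fun y _ => (hG.differentiable one_ne_zero).differentiableAt)
    (fun y hy => by
      have := h (a := x) (b := y) (by rwa [dist_comm]) hx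
      rw [← dist_eq_norm, dist_comm]
      exact le_of_lt this)
    (Metric.mem_ball_self hδ) (by simpa using hv)
  simpa using h1

/-- A sum of `n + 1` terms which are uniformly `o(1 / (n + 1))` tends to zero. -/
theorem tendsto_sum_of_uniform_littleO {φ : ℝ → ℝ → ℂ}
    (hφ : ∀ η > 0, ∃ δ > 0, ∀ x ∈ Icc (0 : ℝ) 1, ∀ ε, 0 < ε → ε < δ → ‖φ x ε‖ ≤ η * ε) :
    Tendsto (fun n : ℕ => ∑ i ∈ Finset.range (n + 1), φ (i / ((n : ℝ) + 1)) (1 / ((n : ℝ) + 1)))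
      atTop (𝓝 0) := by
  rw [Metric.tendsto_nhds]
  intro η hη
  obtain ⟨δ, hδ, h⟩ := hφ (η / 2) (by positivity)
  have hε := tendsto_one_div_add_atTop_nhds_zero_nat (𝕜 := ℝ)
  filter_upwards [hε.eventually (gt_mem_nhds hδ)] with n hn
  have hn0 : (0 : ℝ) < n + 1 := by positivity
  rw [dist_zero_right]
  refine (norm_sum_le _ _).trans_lt ?_
  have h1 : ∀ i ∈ Finset.range (n + 1),
      ‖φ (i / ((n : ℝ) + 1)) (1 / ((n : ℝ) + 1))‖ ≤ η / 2 * (1 / ((n : ℝ) + 1)) := by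
    intro i hi
    refine h _ ⟨by positivity, ?_⟩ _ (by positivity) hn
    rw [div_le_one hn0]
    have : i ≤ n := Nat.lt_succ_iff.1 (Finset.mem_range.1 hi)
    have : (i : ℝ) ≤ n := by exact_mod_cast this
    linarith
  refine (Finset.sum_le_sum h1).trans_lt ?_
  rw [Finset.sum_const, Finset.card_range, nsmul_eq_mul]
  push_cast
  have : ((n : ℝ) + 1) * (η / 2 * (1 / ((n : ℝ) + 1))) = η / 2 := by field_simp
  rw [this]
  linarith

/-- The integral over `[0, 1]` as the sum of the integrals over the cells of a uniform grid. -/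
theorem sum_integral_cells {F : ℝ → ℂ} (hF : ContinuousOn F (Icc 0 1)) (n : ℕ) :
    ∑ i ∈ Finset.range (n + 1),
      ∫ y in ((i : ℝ) / ((n : ℝ) + 1))..(((i + 1 : ℕ) : ℝ) / ((n : ℝ) + 1)), F y =
        ∫ y in (0 : ℝ)..1, F y := by
  have hn0 : (0 : ℝ) < n + 1 := by positivity
  have h := intervalIntegral.sum_integral_adjacent_intervals (f := F) (μ := volume)
    (a := fun i : ℕ => (i : ℝ) / ((n : ℝ) + 1)) (n := n + 1) (fun k hk => by
      refine (hF.mono ?_).intervalIntegrable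
      rw [uIcc_of_le (by gcongr; simp)]
      refine Icc_subset_Icc (by positivity) ?_
      rw [div_le_one hn0]
      exact_mod_cast hk)
  rw [h]
  congr 1
  · simp
  · push_cast; exact div_self hn0.ne'

/-- The trapezoidal rule on a short interval. -/
theorem exists_uniform_trapezoid {F : ℝ → ℂ} (hF : ContDiff ℝ 1 F) {η : ℝ} (hη : 0 < η) :
    ∃ δ > 0, ∀ x ∈ Icc (0 : ℝ) 1, ∀ ε, 0 < ε → ε < δ →
      ‖(F x + F (x + ε)) / 2 - (ε : ℂ)⁻¹ * ∫ y in x..(x + ε), F y‖ ≤ η * ε := by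
  obtain ⟨δ, hδ, h⟩ := exists_uniform_taylor hF (isCompact_Icc (a := (0 : ℝ)) (b := 1))
    (half_pos hη)
  refine ⟨δ, hδ, fun x hx ε hε hεδ => ?_⟩
  set D : ℂ := fderiv ℝ F x 1 with hD
  have hlin : ∀ v : ℝ, fderiv ℝ F x v = v * D := by
    intro v
    rw [hD, ← Complex.real_smul, ← map_smul, smul_eq_mul, mul_one]
  have h1 : ‖F (x + ε) - F x - ε * D‖ ≤ η / 2 * ε := by
    have := h x hx ε (by rwa [Real.norm_of_nonneg hε.le])
    rwa [Real.norm_of_nonneg hε.le, hlin] at this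
  have h2 : ‖∫ y in x..(x + ε), (F y - F x - ((y - x : ℝ) : ℂ) * D)‖ ≤ η / 2 * ε * ε := by
    have := intervalIntegral.norm_integral_le_of_norm_le_const (a := x) (b := x + ε)
      (f := fun y => F y - F x - ((y - x : ℝ) : ℂ) * D) (C := η / 2 * ε) fun y hy => by
        rw [uIoc_of_le (by linarith)] at hy
        have hy0 : 0 ≤ y - x := by linarith [hy.1]
        have h3 := h x hx (y - x) (by rw [Real.norm_of_nonneg hy0]; linarith [hy.2])
        rw [Real.norm_of_nonneg hy0, hlin, add_sub_cancel] at h3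
        refine h3.trans ?_
        have : y - x ≤ ε := by linarith [hy.2]
        gcongr
    rwa [add_sub_cancel_left, abs_of_pos hε] at this
  have hFi : IntervalIntegrable F volume x (x + ε) := hF.continuous.intervalIntegrable _ _
  have h3 : ∫ y in x..(x + ε), (F y - F x - ((y - x : ℝ) : ℂ) * D) =
      (∫ y in x..(x + ε), F y) - ε * F x - ε ^ 2 / 2 * D := by
    rw [intervalIntegral.integral_sub (hFi.sub intervalIntegrable_const)
      (Continuous.intervalIntegrable (by fun_prop) _ _),
      intervalIntegral.integral_sub hFi intervalIntegrable_const,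
      intervalIntegral.integral_mul_const, intervalIntegral.integral_const,
      intervalIntegral.integral_ofReal, add_sub_cancel_left, Complex.real_smul]
    congr 2
    rw [intervalIntegral.integral_comp_sub_right (fun y => y), integral_id]
    push_cast
    ring
  rw [h3] at h2
  have hεC : (ε : ℂ) ≠ 0 := by exact_mod_cast hε.ne'
  -- The trapezoidal rule is exact on affine functions, so only the two Taylor errors remain.
  have h4 : (F x + F (x + ε)) / 2 - (ε : ℂ)⁻¹ * ∫ y in x..(x + ε), F y =
      (F (x + ε) - F x - ε * D) / 2 -
        (ε : ℂ)⁻¹ * ((∫ y in x..(x + ε), F y) - ε * F x - ε ^ 2 / 2 * D) := by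
    field_simp
    ring
  rw [h4]
  refine (norm_sub_le _ _).trans ?_
  rw [norm_div, norm_mul, norm_inv, Complex.norm_real, Real.norm_of_nonneg hε.le]
  have h5 : ε⁻¹ * ‖(∫ y in x..(x + ε), F y) - ε * F x - ε ^ 2 / 2 * D‖ ≤ η / 2 * ε := by
    rw [inv_mul_le_iff₀ hε]
    linarith
  have h6 : ‖F (x + ε) - F x - ε * D‖ / ‖(2 : ℂ)‖ ≤ η / 2 * ε := by
    rw [Complex.norm_ofNat]
    have := norm_nonneg (F (x + ε) - F x - ε * D)
    linarith
  linarith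

/-- The first-order Euler–Maclaurin formula for left Riemann sums. -/
theorem tendsto_leftSum_sub_integral {F : ℝ → ℂ} (hF : ContDiff ℝ 1 F) :
    Tendsto (fun n : ℕ => ∑ i ∈ Finset.range (n + 1), F (i / ((n : ℝ) + 1)) -
      ((n : ℂ) + 1) * ∫ y in (0 : ℝ)..1, F y) atTop (𝓝 ((F 0 - F 1) / 2)) := by
  have h := tendsto_sum_of_uniform_littleO fun η hη => exists_uniform_trapezoid hF hη
  have h1 := h.add_const ((F 0 - F 1) / 2)
  rw [zero_add] at h1
  refine h1.congr fun n => ?_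
  have hn0 : (0 : ℝ) < n + 1 := by positivity
  have hcell : ∀ i : ℕ, (i : ℝ) / ((n : ℝ) + 1) + 1 / ((n : ℝ) + 1) =
      ((i + 1 : ℕ) : ℝ) / ((n : ℝ) + 1) := fun i => by push_cast; ring
  have htel := Finset.sum_range_sub (fun i : ℕ => F (i / ((n : ℝ) + 1))) (n + 1)
  have hone : ((n + 1 : ℕ) : ℝ) / ((n : ℝ) + 1) = 1 := by push_cast; exact div_self hn0.ne'
  simp only [hone, Nat.cast_zero, zero_div] at htel
  simp only [hcell]
  rw [Finset.sum_sub_distrib, ← Finset.mul_sum, sum_integral_cells hF.continuous.continuousOn]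
  -- The trapezoidal sum exceeds the left sum by half of a telescoping sum.
  have h2 : ∑ i ∈ Finset.range (n + 1),
      (F (i / ((n : ℝ) + 1)) + F (((i + 1 : ℕ) : ℝ) / ((n : ℝ) + 1))) / 2 =
      ∑ i ∈ Finset.range (n + 1), F (i / ((n : ℝ) + 1)) + (F 1 - F 0) / 2 := by
    rw [← htel, Finset.sum_div, ← Finset.sum_add_distrib]
    refine Finset.sum_congr rfl fun i _ => ?_
    ring
  rw [h2]
  push_cast
  rw [one_div, inv_inv]
  ring

/-- Symmetric second differences in the second variable are negligible. -/
theorem tendsto_sum_symm_difference {G : ℝ × ℝ → ℂ} (hG : ContDiff ℝ 1 G) :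
    Tendsto (fun n : ℕ => ∑ i ∈ Finset.range (n + 1),
      (G (i / ((n : ℝ) + 1), 1 / ((n : ℝ) + 1)) + G (i / ((n : ℝ) + 1), -(1 / ((n : ℝ) + 1))) -
        2 * G (i / ((n : ℝ) + 1), 0))) atTop (𝓝 0) := by
  refine tendsto_sum_of_uniform_littleO
    (φ := fun x ε => G (x, ε) + G (x, -ε) - 2 * G (x, 0)) fun η hη => ?_
  obtain ⟨δ, hδ, h⟩ := exists_uniform_taylor hG
    ((isCompact_Icc (a := (0 : ℝ)) (b := 1)).prod (isCompact_singleton (x := (0 : ℝ))))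
    (half_pos hη)
  refine ⟨δ, hδ, fun x hx ε hε hεδ => ?_⟩
  have hn : ‖((0, ε) : ℝ × ℝ)‖ = ε := by simp [Prod.norm_def, abs_of_pos hε, hε.le]
  have h1 := h (x, 0) ⟨hx, rfl⟩ (0, ε) (by rwa [hn])
  have h2 := h (x, 0) ⟨hx, rfl⟩ (-(0, ε)) (by rwa [norm_neg, hn])
  rw [norm_neg, map_neg] at h2
  rw [hn] at h1 h2
  -- The derivative terms cancel by symmetry, so `C¹` regularity suffices for an `o(ε)` bound.
  have h3 : G (x, ε) + G (x, -ε) - 2 * G (x, 0) =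
      (G ((x, 0) + (0, ε)) - G (x, 0) - fderiv ℝ G (x, 0) (0, ε)) +
      (G ((x, 0) + -(0, ε)) - G (x, 0) - -fderiv ℝ G (x, 0) (0, ε)) := by
    simp only [Prod.neg_mk, Prod.mk_add_mk, add_zero, zero_add, neg_zero]
    ring
  rw [h3]
  exact (norm_add_le _ _).trans (by linarith)

theorem sum_range_truncate (f : ℕ → ℂ) {M N n : ℕ} (hn : M + N ≤ n) :
    (∑ i ∈ Finset.range (n + 1), if M ≤ i ∧ i + N ≤ n then f i else 0) =
      ∑ i ∈ Finset.range (n + 1), f i - ∑ i ∈ Finset.range M, f i -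
        ∑ i ∈ Finset.range N, f (n + 1 - N + i) := by
  obtain ⟨r, rfl⟩ := Nat.exists_eq_add_of_le hn
  have e : M + N + r + 1 = M + (r + 1) + N := by ring
  have e2 : M + (r + 1) + N - N = M + (r + 1) := by omega
  rw [e, e2, Finset.sum_range_add _ (M + (r + 1)), Finset.sum_range_add _ M,
    Finset.sum_range_add f (M + (r + 1)), Finset.sum_range_add f M]
  have h1 : (∑ x ∈ Finset.range M, if M ≤ x ∧ x + N ≤ M + N + r then f x else 0) = 0 :=
    Finset.sum_eq_zero fun x hx => if_neg (by have := Finset.mem_range.1 hx; omega)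
  have h2 : (∑ x ∈ Finset.range (r + 1),
      if M ≤ M + x ∧ M + x + N ≤ M + N + r then f (M + x) else 0) =
      ∑ x ∈ Finset.range (r + 1), f (M + x) :=
    Finset.sum_congr rfl fun x hx => if_pos (by have := Finset.mem_range.1 hx; omega)
  have h3 : (∑ x ∈ Finset.range N, if M ≤ M + (r + 1) + x ∧ M + (r + 1) + x + N ≤ M + N + r then
      f (M + (r + 1) + x) else 0) = 0 :=
    Finset.sum_eq_zero fun x hx => if_neg (by omega)
  rw [h1, h2, h3]
  ring

/-- Sums truncated near both end points differ from full sums by boundary values, in the limit. -/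
theorem tendsto_sum_truncate {G : ℝ × ℝ → ℂ} (hG : Continuous G) (M N : ℕ) {e : ℕ → ℝ}
    (he : Tendsto e atTop (𝓝 0)) :
    Tendsto (fun n : ℕ => (∑ i ∈ Finset.range (n + 1),
      if M ≤ i ∧ i + N ≤ n then G (i / ((n : ℝ) + 1), e n) else 0) -
        ∑ i ∈ Finset.range (n + 1), G (i / ((n : ℝ) + 1), e n)) atTop
      (𝓝 (-(M * G (0, 0)) - N * G (1, 0))) := by
  have hinv := tendsto_one_div_add_atTop_nhds_zero_nat (𝕜 := ℝ)
  have h1 : Tendsto (fun n : ℕ => ∑ i ∈ Finset.range M, G ((i : ℝ) / ((n : ℝ) + 1), e n)) atTop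
      (𝓝 (∑ i ∈ Finset.range M, G (0, 0))) := by
    refine tendsto_finsetSum _ fun i _ => ?_
    refine (hG.tendsto (0, 0)).comp (Tendsto.prodMk_nhds ?_ he)
    have := hinv.const_mul (i : ℝ)
    rw [mul_zero] at this
    exact this.congr fun n => by ring
  have h2 : Tendsto (fun n : ℕ => ∑ i ∈ Finset.range N,
      G (((n + 1 - N + i : ℕ) : ℝ) / ((n : ℝ) + 1), e n)) atTop
      (𝓝 (∑ i ∈ Finset.range N, G (1, 0))) := by
    refine tendsto_finsetSum _ fun i _ => ?_
    refine (hG.tendsto (1, 0)).comp (Tendsto.prodMk_nhds ?_ he)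
    have := (hinv.const_mul ((i : ℝ) - N)).const_add 1
    rw [mul_zero, add_zero] at this
    refine this.congr' ?_
    filter_upwards [eventually_ge_atTop N] with n hn
    have hn0 : (n : ℝ) + 1 ≠ 0 := by positivity
    push_cast [Nat.cast_sub (show N ≤ n + 1 by omega)]
    field_simp
    ring
  rw [Finset.sum_const, Finset.card_range, nsmul_eq_mul] at h1 h2
  refine (h1.neg.sub h2).congr' ?_
  filter_upwards [eventually_ge_atTop (M + N)] with n hn
  rw [sum_range_truncate (fun i => G (i / ((n : ℝ) + 1), e n)) hn]
  ring

/-- The limit of a symmetrized truncated sum of products of shifted functions. -/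
theorem tendsto_symm_truncated_sum {p : ℕ} {g : Fin p → ℝ → ℂ} (hg : ∀ j, ContDiff ℝ 1 (g j))
    (σ : Fin p → ℝ) (M N : ℕ) :
    Tendsto (fun n : ℕ =>
      ((∑ i ∈ Finset.range (n + 1),
        if M ≤ i ∧ i + N ≤ n then ∏ j, g j ((i + σ j) / ((n : ℝ) + 1)) else 0) -
          ((n : ℂ) + 1) * ∫ y in (0 : ℝ)..1, ∏ j, g j y) +
      ((∑ i ∈ Finset.range (n + 1),
        if N ≤ i ∧ i + M ≤ n then ∏ j, g j ((i - σ j) / ((n : ℝ) + 1)) else 0) -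
          ((n : ℂ) + 1) * ∫ y in (0 : ℝ)..1, ∏ j, g j y)) atTop
      (𝓝 ((∏ j, g j 0 - ∏ j, g j 1) - (N + M) * (∏ j, g j 0 + ∏ j, g j 1))) := by
  -- The shift size becomes a second variable: `±1/(n+1)` gives the two shifted products and `0` the
  -- unshifted one.
  set G : ℝ × ℝ → ℂ := fun z => ∏ j, g j (z.1 + z.2 * σ j) with hGdef
  have hG : ContDiff ℝ 1 G := contDiff_prod fun j _ =>
    (hg j).comp (contDiff_fst.add (contDiff_snd.mul contDiff_const))
  have hF : ContDiff ℝ 1 fun y => ∏ j, g j y := contDiff_prod fun j _ => hg j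
  have hinv := tendsto_one_div_add_atTop_nhds_zero_nat (𝕜 := ℝ)
  have hinv' : Tendsto (fun n : ℕ => -(1 / ((n : ℝ) + 1))) atTop (𝓝 0) := by simpa using hinv.neg
  have h0 : ∀ x, G (x, 0) = ∏ j, g j x := fun x => by simp [hGdef]
  have hp : ∀ n i : ℕ, G (i / ((n : ℝ) + 1), 1 / ((n : ℝ) + 1)) =
      ∏ j, g j ((i + σ j) / ((n : ℝ) + 1)) := fun n i => by
    simp only [hGdef]
    refine Finset.prod_congr rfl fun j _ => ?_
    congr 1
    ring
  have hm : ∀ n i : ℕ, G (i / ((n : ℝ) + 1), -(1 / ((n : ℝ) + 1))) =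
      ∏ j, g j ((i - σ j) / ((n : ℝ) + 1)) := fun n i => by
    simp only [hGdef]
    refine Finset.prod_congr rfl fun j _ => ?_
    congr 1
    ring
  have h1 := tendsto_sum_truncate hG.continuous M N hinv
  have h2 := tendsto_sum_truncate hG.continuous N M hinv'
  have h3 := tendsto_sum_symm_difference hG
  have h4 := (tendsto_leftSum_sub_integral hF).const_mul 2
  have h5 := ((h1.add h2).add h3).add h4
  simp only [h0, hp, hm] at h5
  refine (h5.congr fun n => ?_).trans_eq ?_
  · rw [Finset.sum_sub_distrib, Finset.sum_add_distrib, ← Finset.mul_sum]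
    ring
  · congr 1
    ring

/-! ### Extension, sup norms and product estimates -/

/-- A continuously differentiable function on `[0, 1]` extends to the real line. -/
theorem exists_contDiff_extension {f : ℝ → ℂ} (hf : ContDiffOn ℝ 1 f (Icc 0 1)) :
    ∃ g : ℝ → ℂ, ContDiff ℝ 1 g ∧ EqOn f g (Icc 0 1) := by
  -- The derivative is extended by its end values and then integrated.
  set D : ℝ → ℂ := IccExtend (zero_le_one (α := ℝ)) ((Icc (0 : ℝ) 1).domRestrict
    (derivWithin f (Icc 0 1))) with hD
  have hDc : Continuous D := by
    refine Continuous.Icc_extend' (continuousOn_iff_continuous_domRestrict.1 ?_)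
    exact hf.continuousOn_derivWithin (uniqueDiffOn_Icc zero_lt_one) le_rfl
  have hd : ∀ x, HasDerivAt (fun x => f 0 + ∫ t in (0 : ℝ)..x, D t) (D x) x := fun x =>
    (intervalIntegral.integral_hasDerivAt_right (hDc.intervalIntegrable _ _)
      (hDc.stronglyMeasurableAtFilter _ _) hDc.continuousAt).const_add _
  refine ⟨fun x => f 0 + ∫ t in (0 : ℝ)..x, D t, ?_, fun x hx => ?_⟩
  · rw [contDiff_one_iff_deriv]
    refine ⟨fun x => (hd x).differentiableAt, ?_⟩
    rwa [funext fun x => (hd x).deriv]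
  · have h := intervalIntegral.integral_eq_sub_of_hasDeriv_right_of_le (f := f) (f' := D) hx.1
      (hf.continuousOn.mono (Icc_subset_Icc_right hx.2)) (fun y hy => by
        have hy' : y ∈ Ioo (0 : ℝ) 1 := ⟨hy.1, hy.2.trans_le hx.2⟩
        have h1 : HasDerivWithinAt f (derivWithin f (Icc 0 1) y) (Icc 0 1) y :=
          (hf.differentiableOn one_ne_zero y (Ioo_subset_Icc_self hy')).hasDerivWithinAt
        have h2 := (h1.hasDerivAt (Icc_mem_nhds hy'.1 hy'.2)).hasDerivWithinAt (s := Ioi y)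
        rwa [hD, IccExtend_of_mem _ _ (Ioo_subset_Icc_self hy')])
      (hDc.intervalIntegrable _ _)
    simp [h]

theorem norm_le_supNorm {f : ℝ → ℂ} (hf : ContinuousOn f (Icc 0 1)) {x : ℝ}
    (hx : x ∈ Icc (0 : ℝ) 1) : ‖f x‖ ≤ supNorm f := by
  obtain ⟨C, hC⟩ := isCompact_Icc.exists_bound_of_continuousOn hf
  refine le_ciSup (f := fun x : Icc (0 : ℝ) 1 => ‖f x‖) ⟨C, ?_⟩ ⟨x, hx⟩
  rintro _ ⟨y, rfl⟩
  exact hC y y.2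

theorem supNorm_nonneg (f : ℝ → ℂ) : 0 ≤ supNorm f := Real.iSup_nonneg fun _ => norm_nonneg _

theorem norm_sub_le_supNorm_derivWithin {f : ℝ → ℂ} (hf : ContDiffOn ℝ 1 f (Icc 0 1)) {x y : ℝ}
    (hx : x ∈ Icc (0 : ℝ) 1) (hy : y ∈ Icc (0 : ℝ) 1) :
    ‖f y - f x‖ ≤ supNorm (derivWithin f (Icc 0 1)) * |y - x| :=
  (convex_Icc (0 : ℝ) 1).norm_image_sub_le_of_norm_derivWithin_le
    (hf.differentiableOn one_ne_zero)
    (fun _ hz => norm_le_supNorm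
      (hf.continuousOn_derivWithin (uniqueDiffOn_Icc zero_lt_one) le_rfl) hz) hx hy

/-- Summability with a power weight of exponent at least one gives summability with the weight
`1 + |k|`. -/
theorem summable_one_add_abs_mul {A : ℤ → ℝ} (hA : ∀ k, 0 ≤ A k) {s : ℝ} (hs : 1 ≤ s)
    (h : Summable fun k : ℤ => |(k : ℝ)| ^ s * A k) :
    Summable fun k : ℤ => (1 + |(k : ℝ)|) * A k := by
  -- The term `k = 0` is added separately because the power weight vanishes there.
  have h0 : Summable fun k : ℤ => if k = 0 then A k else 0 :=
    (hasSum_ite_eq (0 : ℤ) (A 0)).summable.congr fun k => by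
      by_cases hk : k = 0
      · simp [hk]
      · simp [hk]
  refine Summable.of_nonneg_of_le (fun k => mul_nonneg (by positivity) (hA k)) (fun k => ?_)
    ((h.mul_left 2).add h0)
  by_cases hk : k = 0
  · subst hk
    have : (0 : ℝ) < s := by linarith
    simp [Real.zero_rpow this.ne']
  · have h1 : (1 : ℝ) ≤ |(k : ℝ)| := by exact_mod_cast Int.one_le_abs hk
    have h2 : |(k : ℝ)| ≤ |(k : ℝ)| ^ s := Real.self_le_rpow_of_one_le h1 hs
    rw [if_neg hk, add_zero, ← mul_assoc]
    exact mul_le_mul_of_nonneg_right (by linarith) (hA k)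

/-- Replace one factor at a time and bound the untouched factors by `A`. -/
theorem norm_prod_sub_prod_le {ι : Type*} [DecidableEq ι] (s : Finset ι) {u v : ι → ℂ}
    {A θ : ι → ℝ} (hu : ∀ j ∈ s, ‖u j‖ ≤ A j) (hv : ∀ j ∈ s, ‖v j‖ ≤ A j)
    (hθ : ∀ j ∈ s, ‖u j - v j‖ ≤ θ j) :
    ‖∏ j ∈ s, u j - ∏ j ∈ s, v j‖ ≤ ∑ j ∈ s, θ j * ∏ l ∈ s.erase j, A l := by
  induction s using Finset.induction_on with
  | empty => simp
  | insert a s ha ih =>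
    have ih' := ih (fun j hj => hu j (Finset.mem_insert_of_mem hj))
      (fun j hj => hv j (Finset.mem_insert_of_mem hj))
      (fun j hj => hθ j (Finset.mem_insert_of_mem hj))
    have hua := hu a (Finset.mem_insert_self _ _)
    have hA : 0 ≤ A a := (norm_nonneg _).trans hua
    have hθa := hθ a (Finset.mem_insert_self _ _)
    have h1 : ‖∏ j ∈ s, v j‖ ≤ ∏ j ∈ s, A j := by
      rw [norm_prod]
      exact Finset.prod_le_prod (fun _ _ => norm_nonneg _)
        fun j hj => hv j (Finset.mem_insert_of_mem hj)
    rw [Finset.prod_insert ha, Finset.prod_insert ha, Finset.sum_insert ha,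
      Finset.erase_insert ha]
    have h2 : ∑ j ∈ s, θ j * ∏ l ∈ (insert a s).erase j, A l =
        A a * ∑ j ∈ s, θ j * ∏ l ∈ s.erase j, A l := by
      rw [Finset.mul_sum]
      refine Finset.sum_congr rfl fun j hj => ?_
      have hne : a ≠ j := fun e => ha (e ▸ hj)
      rw [Finset.erase_insert_of_ne hne, Finset.prod_insert fun h => ha (Finset.mem_of_mem_erase h)]
      ring
    rw [h2]
    calc ‖u a * ∏ j ∈ s, u j - v a * ∏ j ∈ s, v j‖
        = ‖u a * (∏ j ∈ s, u j - ∏ j ∈ s, v j) + (u a - v a) * ∏ j ∈ s, v j‖ := by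
          congr 1; ring
      _ ≤ ‖u a‖ * ‖∏ j ∈ s, u j - ∏ j ∈ s, v j‖ + ‖u a - v a‖ * ‖∏ j ∈ s, v j‖ := by
          refine (norm_add_le _ _).trans ?_
          rw [norm_mul, norm_mul]
      _ ≤ A a * ∑ j ∈ s, θ j * ∏ l ∈ s.erase j, A l + θ a * ∏ j ∈ s, A j := by
          have : 0 ≤ θ a := (norm_nonneg _).trans hθa
          gcongr
      _ = _ := add_comm _ _

/-- This turns a bound linear in the steps into one that factors over them, so that the multiple
series becomes a power of a single series. -/
theorem one_add_sum_le_prod_one_add {ι : Type*} (s : Finset ι) {x : ι → ℝ} (hx : ∀ j, 0 ≤ x j) :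
    1 + ∑ j ∈ s, x j ≤ ∏ j ∈ s, (1 + x j) := by
  classical
  induction s using Finset.induction_on with
  | empty => simp
  | insert a s ha ih =>
    rw [Finset.sum_insert ha, Finset.prod_insert ha]
    have h1 : 0 ≤ ∑ j ∈ s, x j := Finset.sum_nonneg fun j _ => hx j
    nlinarith [hx a]

/-- A comparison of sums over a uniform grid with the integral, cell by cell. -/
theorem norm_sum_sub_integral_le {F : ℝ → ℂ} (hF : ContinuousOn F (Icc 0 1)) (n : ℕ) (w : ℕ → ℂ)
    (b : ℕ → ℝ) (h : ∀ i ∈ Finset.range (n + 1), ∀ y ∈ Icc (0 : ℝ) 1,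
      |y - (i : ℝ) / ((n : ℝ) + 1)| ≤ 1 / ((n : ℝ) + 1) → ‖w i - F y‖ ≤ b i) :
    ‖∑ i ∈ Finset.range (n + 1), w i - ((n : ℂ) + 1) * ∫ y in (0 : ℝ)..1, F y‖ ≤
      ∑ i ∈ Finset.range (n + 1), b i := by
  have hn0 : (0 : ℝ) < n + 1 := by positivity
  have hnC : (n : ℂ) + 1 ≠ 0 := by exact_mod_cast hn0.ne'
  rw [← sum_integral_cells hF n, Finset.mul_sum, ← Finset.sum_sub_distrib]
  refine (norm_sum_le _ _).trans (Finset.sum_le_sum fun i hi => ?_)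
  have hlen : ((i + 1 : ℕ) : ℝ) / ((n : ℝ) + 1) - (i : ℝ) / ((n : ℝ) + 1) = 1 / ((n : ℝ) + 1) := by
    push_cast; ring
  have hle : (i : ℝ) / ((n : ℝ) + 1) ≤ ((i + 1 : ℕ) : ℝ) / ((n : ℝ) + 1) := by
    have : 0 < 1 / ((n : ℝ) + 1) := by positivity
    linarith
  have hsub : Icc ((i : ℝ) / ((n : ℝ) + 1)) (((i + 1 : ℕ) : ℝ) / ((n : ℝ) + 1)) ⊆
      Icc (0 : ℝ) 1 := by
    refine Icc_subset_Icc (by positivity) ?_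
    rw [div_le_one hn0]
    exact_mod_cast Finset.mem_range.1 hi
  have hFi : IntervalIntegrable F volume ((i : ℝ) / ((n : ℝ) + 1))
      (((i + 1 : ℕ) : ℝ) / ((n : ℝ) + 1)) := by
    refine ContinuousOn.intervalIntegrable ?_
    rw [uIcc_of_le hle]
    exact hF.mono hsub
  have h1 : w i - ((n : ℂ) + 1) *
      ∫ y in ((i : ℝ) / ((n : ℝ) + 1))..(((i + 1 : ℕ) : ℝ) / ((n : ℝ) + 1)), F y =
      ((n : ℂ) + 1) *
        ∫ y in ((i : ℝ) / ((n : ℝ) + 1))..(((i + 1 : ℕ) : ℝ) / ((n : ℝ) + 1)), (w i - F y) := by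
    rw [intervalIntegral.integral_sub intervalIntegrable_const hFi,
      intervalIntegral.integral_const, hlen, Complex.real_smul]
    push_cast
    field_simp
  have h2 := intervalIntegral.norm_integral_le_of_norm_le_const
    (a := (i : ℝ) / ((n : ℝ) + 1)) (b := ((i + 1 : ℕ) : ℝ) / ((n : ℝ) + 1))
    (f := fun y => w i - F y) (C := b i) fun y hy => by
      rw [uIoc_of_le hle] at hy
      refine h i hi y (hsub (Ioc_subset_Icc_self hy)) ?_
      rw [abs_le]
      constructor
      · have : 0 < 1 / ((n : ℝ) + 1) := by positivity
        linarith [hy.1]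
      · linarith [hy.2]
  rw [hlen, abs_of_pos (by positivity)] at h2
  rw [h1, norm_mul]
  have h3 : ‖(n : ℂ) + 1‖ = (n : ℝ) + 1 := by
    rw [show (n : ℂ) + 1 = (((n : ℝ) + 1 : ℝ) : ℂ) by push_cast; rfl, Complex.norm_real,
      Real.norm_of_nonneg hn0.le]
  rw [h3]
  calc ((n : ℝ) + 1) * _ ≤ ((n : ℝ) + 1) * (b i * (1 / ((n : ℝ) + 1))) := by gcongr
    _ = b i := by field_simp

/-! ### Path weights and the remainder of one tuple -/

/-- The mean of the positions of a path, relative to its start, before and after step `j`. -/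
def midpoint {p : ℕ} (h : Fin p → ℤ) (j : Fin p) : ℝ :=
  ((partialSum h j : ℝ) + partialSum h (j + 1)) / 2

/-- This sign change cancels the first-order effect of the shifts. -/
theorem midpoint_rev {p : ℕ} {h : Fin p → ℤ} (hh : ∑ j, h j = 0) (j : Fin p) :
    midpoint (h ∘ Fin.rev) j = -midpoint h j.rev := by
  have hj := j.2
  have e1 : ((j.rev : Fin p) : ℕ) + 1 = p - j := by rw [Fin.val_rev]; omega
  have e2 : ((j.rev : Fin p) : ℕ) = p - (j + 1) := Fin.val_rev j
  rw [midpoint, midpoint, partialSum_rev hh hj.le, partialSum_rev hh hj, e1, e2]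
  push_cast
  ring

theorem midpoint_mem_Icc {p : ℕ} {h : Fin p → ℤ} (hh : ∑ j, h j = 0) {i n : ℕ}
    (hv : N (-h) ≤ i ∧ i + N h ≤ n) (j : Fin p) :
    (i + midpoint h j) / ((n : ℝ) + 1) ∈ Icc (0 : ℝ) 1 := by
  have H := (forall_partialSum_mem_iff hh i n).2 hv
  have h1 := H j j.2.le
  have h2 := H (j + 1) j.2
  have a1 : (0 : ℝ) ≤ i + partialSum h j := by exact_mod_cast h1.1
  have a2 : (i + partialSum h j : ℝ) ≤ n := by exact_mod_cast h1.2
  have b1 : (0 : ℝ) ≤ i + partialSum h (j + 1) := by exact_mod_cast h2.1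
  have b2 : (i + partialSum h (j + 1) : ℝ) ≤ n := by exact_mod_cast h2.2
  unfold midpoint
  constructor
  · refine div_nonneg ?_ (by positivity)
    linarith
  · rw [div_le_one (by positivity)]
    linarith

/-- The weights of the closed paths for the matrix `T a n`. -/
theorem pathWeight_T {a : ℝ → ℝ → ℂ} {g : ℤ → ℝ → ℂ}
    (hg : ∀ k, EqOn (coeff a k) (g k) (Icc 0 1)) {p : ℕ} {h : Fin p → ℤ} (hh : ∑ j, h j = 0)
    {i n : ℕ} (hi : i ≤ n) :
    pathWeight (T a n) i h = if N (-h) ≤ i ∧ i + N h ≤ n then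
      ∏ j, g (h j) ((i + midpoint h j) / ((n : ℝ) + 1)) else 0 := by
  split_ifs with hv
  · have H := (forall_partialSum_mem_iff hh i n).2 hv
    refine Finset.prod_congr rfl fun j _ => ?_
    rw [← hg _ (midpoint_mem_Icc hh hv j)]
    have h1 := H j j.2.le
    have h2 := H (j + 1) j.2
    obtain ⟨u, hu⟩ := Int.eq_ofNat_of_zero_le h1.1
    obtain ⟨v, hv'⟩ := Int.eq_ofNat_of_zero_le h2.1
    have hun : u < n + 1 := by omega
    have hvn : v < n + 1 := by omega
    have h3 := intEntry_coe (T a n) ⟨u, hun⟩ ⟨v, hvn⟩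
    dsimp only at h3
    rw [hu, hv', h3, T, Matrix.of_apply]
    have e1 : (v : ℤ) - u = h j := by
      have := partialSum_succ h j
      omega
    dsimp only
    rw [e1]
    congr 1
    have hu' : (u : ℝ) = i + partialSum h j := by exact_mod_cast hu.symm
    have hv'' : (v : ℝ) = i + partialSum h (j + 1) := by exact_mod_cast hv'.symm
    rw [hu', hv'', midpoint]
    have : (n : ℝ) + 1 ≠ 0 := by positivity
    field_simp
    ring
  · rw [← forall_partialSum_mem_iff hh] at hv
    push Not at hv
    obtain ⟨m, hm, hv⟩ := hv
    -- A position outside `[0, n]` with `m < p` is the row index of a vanishing factor; at `m = p`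
    -- the path is back at its start.
    rcases hm.lt_or_eq with hm | rfl
    · refine Finset.prod_eq_zero (Finset.mem_univ ⟨m, hm⟩) (if_neg ?_)
      intro H
      exact (hv H.1.1).not_ge H.1.2
    · rw [partialSum_length, hh] at hv
      have := hv (by positivity)
      omega

/-- The difference between the contribution of the closed paths with steps `h` to the trace and its
leading term. -/
def remainder (a : ℝ → ℝ → ℂ) (n : ℕ) {p : ℕ} (h : Fin p → ℤ) : ℂ :=
  ∑ i ∈ Finset.range (n + 1), pathWeight (T a n) i h -
    ((n : ℂ) + 1) * ∫ y in (0 : ℝ)..1, ∏ j, coeff a (h j) y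

/-- The weights that dominate the Fourier coefficients and their derivatives. -/
def weight (a : ℝ → ℝ → ℂ) (k : ℤ) : ℝ :=
  (1 + |(k : ℝ)|) * supNorm (coeff a k) + supNorm (derivWithin (coeff a k) (Icc 0 1))

theorem sum_abs_mul_prod_supNorm_le (a : ℝ → ℝ → ℂ) {p : ℕ} (h : Fin p → ℤ) :
    (∑ l, |(h l : ℝ)|) * ∏ j, supNorm (coeff a (h j)) ≤ ∏ j, weight a (h j) := by
  have h1 := one_add_sum_le_prod_one_add Finset.univ (x := fun l => |(h l : ℝ)|)
    fun _ => abs_nonneg _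
  have h2 : 0 ≤ ∏ j, supNorm (coeff a (h j)) := Finset.prod_nonneg fun _ _ => supNorm_nonneg _
  calc (∑ l, |(h l : ℝ)|) * ∏ j, supNorm (coeff a (h j))
      ≤ (∏ l, (1 + |(h l : ℝ)|)) * ∏ j, supNorm (coeff a (h j)) := by
        gcongr
        linarith
    _ = ∏ j, (1 + |(h j : ℝ)|) * supNorm (coeff a (h j)) := Finset.prod_mul_distrib.symm
    _ ≤ _ := by
        refine Finset.prod_le_prod (fun j _ => mul_nonneg (by positivity) (supNorm_nonneg _))
          fun j _ => ?_
        exact le_add_of_nonneg_right (supNorm_nonneg _)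

theorem card_not_valid_le (M N n : ℕ) :
    ((Finset.range (n + 1)).filter fun i => ¬(M ≤ i ∧ i + N ≤ n)).card ≤ M + N := by
  have h1 : (Finset.range (n + 1)).filter (fun i => ¬(M ≤ i ∧ i + N ≤ n)) ⊆
      Finset.range M ∪ Finset.Ico (n + 1 - N) (n + 1) := by
    intro i hi
    simp only [Finset.mem_filter, Finset.mem_range, Finset.mem_union, Finset.mem_Ico] at hi ⊢
    omega
  refine (Finset.card_le_card h1).trans ((Finset.card_union_le _ _).trans ?_)
  rw [Finset.card_range, Nat.card_Ico]
  omega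

theorem N_le_sum_abs_real {p : ℕ} {h : Fin p → ℤ} (hh : ∑ j, h j = 0) :
    (N h : ℝ) ≤ ∑ l, |(h l : ℝ)| := by
  exact_mod_cast N_le_sum_abs hh

/-- The bound on the remainder that is uniform in `n`. -/
theorem norm_remainder_le {a : ℝ → ℝ → ℂ} (hc : ∀ k, ContDiffOn ℝ 1 (coeff a k) (Icc 0 1))
    (n : ℕ) {p : ℕ} {h : Fin p → ℤ} (hh : ∑ j, h j = 0) :
    ‖remainder a n h‖ ≤ (p + 2) * ∏ j, weight a (h j) := by
  have hn0 : (0 : ℝ) < n + 1 := by positivity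
  have hh' : ∑ j, (-h) j = 0 := by simp [hh]
  have hF : ContinuousOn (fun y => ∏ j, coeff a (h j) y) (Icc 0 1) :=
    continuousOn_finsetProd _ fun j _ => (hc _).continuousOn
  have hA : ∀ y ∈ Icc (0 : ℝ) 1, ∀ j, ‖coeff a (h j) y‖ ≤ supNorm (coeff a (h j)) :=
    fun y hy j => norm_le_supNorm (hc _).continuousOn hy
  set P := ∏ j, weight a (h j) with hP
  set Q := ∏ j, supNorm (coeff a (h j)) with hQ
  -- Admissible starts have error `O(1/(n+1))`. The others have only the trivial bound `Q`, but
  -- there are at most `N(-h) + N(h)` of them.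
  have key : ∀ i ∈ Finset.range (n + 1), ∀ y ∈ Icc (0 : ℝ) 1,
      |y - (i : ℝ) / ((n : ℝ) + 1)| ≤ 1 / ((n : ℝ) + 1) →
      ‖pathWeight (T a n) i h - ∏ j, coeff a (h j) y‖ ≤
        if ¬(N (-h) ≤ i ∧ i + N h ≤ n) then Q else p * P * (1 / ((n : ℝ) + 1)) := by
    intro i hi y hy hiy
    have hin : i ≤ n := Nat.lt_succ_iff.1 (Finset.mem_range.1 hi)
    rw [pathWeight_T (g := coeff a) (fun k => eqOn_refl _ _) hh hin]
    by_cases hv : N (-h) ≤ i ∧ i + N h ≤ n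
    · rw [if_pos hv, if_neg (not_not.2 hv)]
      have hx := midpoint_mem_Icc hh hv
      refine (norm_prod_sub_prod_le Finset.univ
        (A := fun j => supNorm (coeff a (h j)))
        (θ := fun j => supNorm (derivWithin (coeff a (h j)) (Icc 0 1)) *
          ((1 + ∑ l ∈ Finset.univ.erase j, |(h l : ℝ)|) * (1 / ((n : ℝ) + 1))))
        (fun j _ => hA _ (hx j) j) (fun j _ => hA _ hy j) fun j _ => ?_).trans ?_
      · refine (norm_sub_le_supNorm_derivWithin (hc (h j)) hy (hx j)).trans ?_
        refine mul_le_mul_of_nonneg_left ?_ (supNorm_nonneg _)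
        -- Omitting `h j` is essential: factor `j` already carries a derivative, and `weight` has no
        -- term `|k| ‖â_k'‖`.
        have h1 : |midpoint h j| ≤ ∑ l ∈ Finset.univ.erase j, |(h l : ℝ)| := by
          have h2 : |(partialSum h j : ℝ) + partialSum h (j + 1)| ≤
              2 * ∑ l ∈ Finset.univ.erase j, |(h l : ℝ)| := by
            exact_mod_cast abs_partialSum_add_le hh j
          rw [midpoint, abs_div, abs_two]
          linarith
        have h3 : (i + midpoint h j) / ((n : ℝ) + 1) - y =
            midpoint h j * (1 / ((n : ℝ) + 1)) - (y - (i : ℝ) / ((n : ℝ) + 1)) := by ring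
        rw [h3]
        refine (abs_sub _ _).trans ?_
        rw [abs_mul, abs_of_pos (show 0 < 1 / ((n : ℝ) + 1) by positivity)]
        have h4 : |midpoint h j| * (1 / ((n : ℝ) + 1)) ≤
            (∑ l ∈ Finset.univ.erase j, |(h l : ℝ)|) * (1 / ((n : ℝ) + 1)) := by gcongr
        linarith
      · have h5 : ∀ j ∈ (Finset.univ : Finset (Fin p)),
            supNorm (derivWithin (coeff a (h j)) (Icc 0 1)) *
              ((1 + ∑ l ∈ Finset.univ.erase j, |(h l : ℝ)|) * (1 / ((n : ℝ) + 1))) *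
                ∏ l ∈ Finset.univ.erase j, supNorm (coeff a (h l)) ≤
            P * (1 / ((n : ℝ) + 1)) := by
          intro j _
          have h6 := one_add_sum_le_prod_one_add (Finset.univ.erase j)
            (x := fun l => |(h l : ℝ)|) fun _ => abs_nonneg _
          have h7 : 0 ≤ ∏ l ∈ Finset.univ.erase j, supNorm (coeff a (h l)) :=
            Finset.prod_nonneg fun _ _ => supNorm_nonneg _
          have h8 : (1 + ∑ l ∈ Finset.univ.erase j, |(h l : ℝ)|) *
              ∏ l ∈ Finset.univ.erase j, supNorm (coeff a (h l)) ≤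
              ∏ l ∈ Finset.univ.erase j, weight a (h l) := by
            refine (mul_le_mul_of_nonneg_right h6 h7).trans ?_
            rw [← Finset.prod_mul_distrib]
            refine Finset.prod_le_prod (fun l _ => mul_nonneg (by positivity) (supNorm_nonneg _))
              fun l _ => ?_
            exact le_add_of_nonneg_right (supNorm_nonneg _)
          have h9 : supNorm (derivWithin (coeff a (h j)) (Icc 0 1)) ≤ weight a (h j) :=
            le_add_of_nonneg_left (mul_nonneg (by positivity) (supNorm_nonneg _))
          have h10 : supNorm (derivWithin (coeff a (h j)) (Icc 0 1)) *
              ((1 + ∑ l ∈ Finset.univ.erase j, |(h l : ℝ)|) *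
                ∏ l ∈ Finset.univ.erase j, supNorm (coeff a (h l))) ≤ P := by
            rw [hP, ← Finset.mul_prod_erase _ _ (Finset.mem_univ j)]
            refine mul_le_mul h9 h8 (mul_nonneg ?_ h7) ((supNorm_nonneg _).trans h9)
            have : 0 ≤ ∑ l ∈ Finset.univ.erase j, |(h l : ℝ)| :=
              Finset.sum_nonneg fun _ _ => abs_nonneg _
            linarith
          calc _ = supNorm (derivWithin (coeff a (h j)) (Icc 0 1)) *
              ((1 + ∑ l ∈ Finset.univ.erase j, |(h l : ℝ)|) *
                ∏ l ∈ Finset.univ.erase j, supNorm (coeff a (h l))) * (1 / ((n : ℝ) + 1)) := by ring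
            _ ≤ _ := by gcongr
        refine (Finset.sum_le_sum h5).trans_eq ?_
        rw [Finset.sum_const, Finset.card_univ, Fintype.card_fin, nsmul_eq_mul, mul_assoc]
    · rw [if_neg hv, if_pos hv, zero_sub, norm_neg, norm_prod]
      exact Finset.prod_le_prod (fun _ _ => norm_nonneg _) fun j _ => hA y hy j
  refine (norm_sum_sub_integral_le hF n _ _ key).trans ?_
  have hQ0 : 0 ≤ Q := Finset.prod_nonneg fun _ _ => supNorm_nonneg _
  have hP0 : 0 ≤ P := Finset.prod_nonneg fun _ _ =>
    add_nonneg (mul_nonneg (by positivity) (supNorm_nonneg _)) (supNorm_nonneg _)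
  rw [Finset.sum_ite, Finset.sum_const, Finset.sum_const, nsmul_eq_mul, nsmul_eq_mul]
  have hc1 : (((Finset.range (n + 1)).filter fun i => ¬(N (-h) ≤ i ∧ i + N h ≤ n)).card : ℝ) ≤
      2 * ∑ l, |(h l : ℝ)| := by
    have h1 := N_le_sum_abs_real hh
    have h2 := N_le_sum_abs_real hh'
    simp only [Pi.neg_apply, Int.cast_neg, abs_neg] at h2
    have h3 : (((Finset.range (n + 1)).filter fun i => ¬(N (-h) ≤ i ∧ i + N h ≤ n)).card : ℝ) ≤
        N (-h) + N h := by exact_mod_cast card_not_valid_le (N (-h)) (N h) n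
    linarith
  have hc2 : (((Finset.range (n + 1)).filter
      fun i => ¬¬(N (-h) ≤ i ∧ i + N h ≤ n)).card : ℝ) ≤ (n : ℝ) + 1 := by
    have := Finset.card_filter_le (Finset.range (n + 1)) fun i => ¬¬(N (-h) ≤ i ∧ i + N h ≤ n)
    rw [Finset.card_range] at this
    exact_mod_cast this
  have h4 := sum_abs_mul_prod_supNorm_le a h
  -- The `2` comes from the two excluded ends, the `p` from the choice of the differentiated factor.
  calc _ ≤ (2 * ∑ l, |(h l : ℝ)|) * Q + ((n : ℝ) + 1) * (p * P * (1 / ((n : ℝ) + 1))) := by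
        gcongr
    _ = 2 * ((∑ l, |(h l : ℝ)|) * Q) + p * P := by field_simp
    _ ≤ 2 * P + p * P := by gcongr
    _ = _ := by ring

/-- The limit of the remainder, symmetrized under reversal of the steps. -/
theorem tendsto_remainder_add_rev {a : ℝ → ℝ → ℂ}
    (hc : ∀ k, ContDiffOn ℝ 1 (coeff a k) (Icc 0 1)) {p : ℕ} {h : Fin p → ℤ}
    (hh : ∑ j, h j = 0) :
    Tendsto (fun n => remainder a n h + remainder a n (h ∘ Fin.rev)) atTop
      (𝓝 ((∏ j, coeff a (h j) 0 - ∏ j, coeff a (h j) 1) -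
        (edgeTerm a h + edgeTerm a (h ∘ Fin.rev)))) := by
  -- The full comparison sums also evaluate at shifted points outside `[0, 1]`.
  choose g hg hgeq using fun k => exists_contDiff_extension (hc k)
  have hrev : ∀ f : Fin p → ℂ, ∏ j : Fin p, f (Fin.rev j) = ∏ j, f j := fun f => Equiv.prod_comp Fin.revPerm f
  have hh' : ∑ j, (h ∘ Fin.rev) j = 0 := by rw [sum_rev, hh]
  have hN : N (-(h ∘ Fin.rev)) = N h := by
    rw [← N_rev hh']
    congr 1
    funext j
    simp
  have hint : ∀ y ∈ Icc (0 : ℝ) 1, ∏ j, coeff a (h j) y = ∏ j, g (h j) y := fun y hy =>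
    Finset.prod_congr rfl fun j _ => hgeq _ hy
  have hI : ∫ y in (0 : ℝ)..1, ∏ j, coeff a (h j) y = ∫ y in (0 : ℝ)..1, ∏ j, g (h j) y := by
    refine intervalIntegral.integral_congr fun y hy => ?_
    rw [uIcc_of_le zero_le_one] at hy
    exact hint y hy
  have hlim := tendsto_symm_truncated_sum (fun j => hg (h j)) (midpoint h) (N (-h)) (N h)
  have e : ∀ y, ∏ j, coeff a ((h ∘ Fin.rev) j) y = ∏ j, coeff a (h j) y := fun y =>
    hrev fun j => coeff a (h j) y
  refine (hlim.congr fun n => ?_).trans_eq ?_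
  · rw [remainder, remainder]
    simp only [e]
    rw [hI]
    congr 2
    · refine Finset.sum_congr rfl fun i hi => ?_
      exact (pathWeight_T hgeq hh (Nat.lt_succ_iff.1 (Finset.mem_range.1 hi))).symm
    · refine Finset.sum_congr rfl fun i hi => ?_
      rw [pathWeight_T hgeq hh' (Nat.lt_succ_iff.1 (Finset.mem_range.1 hi)), hN, N_rev hh]
      congr 1
      rw [← hrev]
      refine Finset.prod_congr rfl fun j _ => ?_
      rw [midpoint_rev hh, sub_eq_add_neg]
      rfl
  · rw [edgeTerm, edgeTerm, N_rev hh, e, e, hint 0 (by simp), hint 1 (by simp)]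
    congr 1
    ring

/-! ### Summation over tuples and passage to the limit -/

/-- Reversal of zero-sum tuples. -/
def revEquiv (p : ℕ) : {h : Fin p → ℤ // ∑ j, h j = 0} ≃ {h : Fin p → ℤ // ∑ j, h j = 0} where
  toFun h := ⟨h.1 ∘ Fin.rev, by rw [sum_rev, h.2]⟩
  invFun h := ⟨h.1 ∘ Fin.rev, by rw [sum_rev, h.2]⟩
  left_inv h := by ext j; simp
  right_inv h := by ext j; simp

theorem summable_prod_weight {a : ℝ → ℝ → ℂ} (hw : Summable (weight a)) (p : ℕ) :
    Summable fun h : {h : Fin p → ℤ // ∑ j, h j = 0} => ∏ j, weight a (h.1 j) := by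
  have h1 := (hasSum_prod_pow (f := weight a) hw.norm p).2.summable
  exact h1.comp_injective Subtype.val_injective

theorem summable_supNorm_coeff {a : ℝ → ℝ → ℂ} (hw : Summable (weight a)) :
    Summable fun k => supNorm (coeff a k) := by
  refine Summable.of_nonneg_of_le (fun k => supNorm_nonneg _) (fun k => ?_) hw
  rw [weight]
  nlinarith [supNorm_nonneg (coeff a k), abs_nonneg (k : ℝ),
    supNorm_nonneg (derivWithin (coeff a k) (Icc 0 1)),
    mul_nonneg (abs_nonneg (k : ℝ)) (supNorm_nonneg (coeff a k))]

theorem summable_edgeTerm {a : ℝ → ℝ → ℂ} (hc : ∀ k, ContDiffOn ℝ 1 (coeff a k) (Icc 0 1))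
    (hw : Summable (weight a)) (p : ℕ) :
    Summable fun h : {h : Fin p → ℤ // ∑ j, h j = 0} => edgeTerm a h.1 := by
  refine Summable.of_norm_bounded ((summable_prod_weight hw p).mul_left 2) fun h => ?_
  have hb : ∀ y ∈ Icc (0 : ℝ) 1,
      ‖∏ j, coeff a (h.1 j) y‖ ≤ ∏ j, supNorm (coeff a (h.1 j)) := fun y hy => by
    rw [norm_prod]
    exact Finset.prod_le_prod (fun _ _ => norm_nonneg _)
      fun j _ => norm_le_supNorm (hc _).continuousOn hy
  have h1 := sum_abs_mul_prod_supNorm_le a h.1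
  have h2 := N_le_sum_abs_real h.2
  rw [edgeTerm, norm_mul, Complex.norm_natCast]
  calc (N h.1 : ℝ) * ‖∏ j, coeff a (h.1 j) 0 + ∏ j, coeff a (h.1 j) 1‖
      ≤ (∑ l, |(h.1 l : ℝ)|) *
        (∏ j, supNorm (coeff a (h.1 j)) + ∏ j, supNorm (coeff a (h.1 j))) := by
        have := (norm_add_le (∏ j, coeff a (h.1 j) 0) (∏ j, coeff a (h.1 j) 1)).trans
          (add_le_add (hb 0 (by simp)) (hb 1 (by simp)))
        gcongr
    _ = 2 * ((∑ l, |(h.1 l : ℝ)|) * ∏ j, supNorm (coeff a (h.1 j))) := by ring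
    _ ≤ _ := by gcongr

/-- The integral of the `p`-th power of the symbol in the second variable. -/
theorem hasSum_prod_coeff {a : ℝ → ℝ → ℂ} (hc : ∀ k, ContDiffOn ℝ 1 (coeff a k) (Icc 0 1))
    (hw : Summable (weight a))
    (ha : ∀ x ∈ Icc (0 : ℝ) 1, ContinuousOn (a x) (Icc 0 (2 * Real.pi))) (p : ℕ) {x : ℝ}
    (hx : x ∈ Icc (0 : ℝ) 1) :
    HasSum (fun h : {h : Fin p → ℤ // ∑ j, h j = 0} => ∏ j, coeff a (h.1 j) x)
      (1 / (2 * Real.pi) * ∫ t in (0 : ℝ)..(2 * Real.pi), a x t ^ p) := by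
  have h1 : Summable fun k => ‖fourierCoeffOn Real.two_pi_pos (a x) k‖ :=
    Summable.of_nonneg_of_le (fun _ => norm_nonneg _)
      (fun k => norm_le_supNorm (hc k).continuousOn hx) (summable_supNorm_coeff hw)
  have h2 := (hasSum_intervalIntegral_pow Real.two_pi_pos (ha x hx) h1 p).mul_left
    (1 / (2 * Real.pi) : ℂ)
  refine hasSum_of_forall_eq h2 fun h => ?_
  have hpi : (Real.pi : ℂ) ≠ 0 := by exact_mod_cast Real.pi_ne_zero
  push_cast
  rw [sub_zero, ← mul_assoc, one_div_mul_cancel (by simp [hpi]), one_mul]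
  rfl

theorem hasSum_integral_prod_coeff {a : ℝ → ℝ → ℂ}
    (hc : ∀ k, ContDiffOn ℝ 1 (coeff a k) (Icc 0 1)) (hw : Summable (weight a))
    (ha : ∀ x ∈ Icc (0 : ℝ) 1, ContinuousOn (a x) (Icc 0 (2 * Real.pi))) (p : ℕ) :
    HasSum (fun h : {h : Fin p → ℤ // ∑ j, h j = 0} =>
        ∫ x in (0 : ℝ)..1, ∏ j, coeff a (h.1 j) x)
      (1 / (2 * Real.pi) *
        ∫ x in (0 : ℝ)..1, ∫ t in (0 : ℝ)..(2 * Real.pi), a x t ^ p) := by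
  rw [← intervalIntegral.integral_const_mul]
  have hmem : ∀ x : ℝ, x ∈ uIoc (0 : ℝ) 1 → x ∈ Icc (0 : ℝ) 1 := fun x hx => by
    rw [uIoc_of_le zero_le_one] at hx
    exact Ioc_subset_Icc_self hx
  have hsum : Summable fun h : {h : Fin p → ℤ // ∑ j, h j = 0} =>
      ∏ j, supNorm (coeff a (h.1 j)) :=
    (hasSum_prod_pow (f := fun k => supNorm (coeff a k))
      (summable_supNorm_coeff hw).norm p).2.summable.comp_injective Subtype.val_injective
  refine intervalIntegral.hasSum_integral_of_dominated_convergence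
    (fun h _ => ∏ j, supNorm (coeff a (h.1 j))) ?_ ?_ ?_ ?_ ?_
  · intro h
    refine ContinuousOn.aestronglyMeasurable ?_ measurableSet_uIoc
    exact continuousOn_finsetProd _ fun j _ => (hc _).continuousOn.mono hmem
  · refine fun h => Eventually.of_forall fun x hx => ?_
    rw [norm_prod]
    exact Finset.prod_le_prod (fun _ _ => norm_nonneg _)
      fun j _ => norm_le_supNorm (hc _).continuousOn (hmem x hx)
  · exact Eventually.of_forall fun x _ => hsum
  · exact intervalIntegrable_const
  · exact Eventually.of_forall fun x hx => hasSum_prod_coeff hc hw ha p (hmem x hx)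

/-- The difference between the trace and its leading term is the sum of the remainders. -/
theorem hasSum_remainder {a : ℝ → ℝ → ℂ}
    (hc : ∀ k, ContDiffOn ℝ 1 (coeff a k) (Icc 0 1)) (hw : Summable (weight a))
    (ha : ∀ x ∈ Icc (0 : ℝ) 1, ContinuousOn (a x) (Icc 0 (2 * Real.pi))) (p n : ℕ) :
    HasSum (fun h : {h : Fin p → ℤ // ∑ j, h j = 0} => remainder a n h.1)
      ((T a n ^ p).trace - ((n : ℂ) + 1) / (2 * Real.pi) *
        ∫ x in (0 : ℝ)..1, ∫ t in (0 : ℝ)..(2 * Real.pi), a x t ^ p) := by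
  have h1 := (hasSum_trace_pow (T a n) p).sub
    ((hasSum_integral_prod_coeff hc hw ha p).mul_left ((n : ℂ) + 1))
  rw [← mul_assoc, mul_one_div] at h1
  exact h1

/-- The second-order trace asymptotics. -/
theorem tendsto_trace_sub {a : ℝ → ℝ → ℂ}
    (hc : ∀ k, ContDiffOn ℝ 1 (coeff a k) (Icc 0 1)) (hw : Summable (weight a))
    (ha : ∀ x ∈ Icc (0 : ℝ) 1, ContinuousOn (a x) (Icc 0 (2 * Real.pi))) (p : ℕ) :
    Tendsto (fun n : ℕ => (T a n ^ p).trace - ((n : ℂ) + 1) / (2 * Real.pi) *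
        ∫ x in (0 : ℝ)..1, ∫ t in (0 : ℝ)..(2 * Real.pi), a x t ^ p) atTop
      (𝓝 (1 / (4 * Real.pi) * (∫ t in (0 : ℝ)..(2 * Real.pi), a 0 t ^ p)
          - 1 / (4 * Real.pi) * (∫ t in (0 : ℝ)..(2 * Real.pi), a 1 t ^ p)
          - ∑' h : {h : Fin p → ℤ // ∑ j, h j = 0}, edgeTerm a h.1)) := by
  set L : {h : Fin p → ℤ // ∑ j, h j = 0} → ℂ := fun h =>
    (∏ j, coeff a (h.1 j) 0 - ∏ j, coeff a (h.1 j) 1) -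
      (edgeTerm a h.1 + edgeTerm a (h.1 ∘ Fin.rev)) with hL
  have hlim : Tendsto (fun n : ℕ => ∑' h : {h : Fin p → ℤ // ∑ j, h j = 0},
      (remainder a n h.1 + remainder a n (h.1 ∘ Fin.rev))) atTop (𝓝 (∑' h, L h)) := by
    refine tendsto_tsum_of_dominated_convergence
      ((summable_prod_weight hw p).mul_left (2 * ((p : ℝ) + 2)))
      (fun h => tendsto_remainder_add_rev hc h.2) (Eventually.of_forall fun n h => ?_)
    have h1 := norm_remainder_le hc n h.2
    have h2 := norm_remainder_le hc n (h := h.1 ∘ Fin.rev) (by rw [sum_rev, h.2])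
    have h3 : ∏ j, weight a ((h.1 ∘ Fin.rev) j) = ∏ j, weight a (h.1 j) :=
      Equiv.prod_comp Fin.revPerm fun j => weight a (h.1 j)
    rw [h3] at h2
    refine (norm_add_le _ _).trans ?_
    linarith
  have hsum : ∀ n : ℕ, ∑' h : {h : Fin p → ℤ // ∑ j, h j = 0},
      (remainder a n h.1 + remainder a n (h.1 ∘ Fin.rev)) =
      2 * ((T a n ^ p).trace - ((n : ℂ) + 1) / (2 * Real.pi) *
        ∫ x in (0 : ℝ)..1, ∫ t in (0 : ℝ)..(2 * Real.pi), a x t ^ p) := by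
    intro n
    have h1 := hasSum_remainder hc hw ha p n
    -- Reindexing by reversal shows that the symmetrized series is twice the original one; the
    -- factor is divided out at the end.
    have h2 := (revEquiv p).hasSum_iff.2 h1
    rw [two_mul]
    exact (h1.add h2).tsum_eq
  have hE := (summable_edgeTerm hc hw p).hasSum
  have hE' := (revEquiv p).hasSum_iff.2 hE
  have h0 := hasSum_prod_coeff hc hw ha p (x := 0) (by simp)
  have h1 := hasSum_prod_coeff hc hw ha p (x := 1) (by simp)
  have hLs : ∑' h, L h = _ := ((h0.sub h1).sub (hE.add hE')).tsum_eq
  rw [hLs] at hlim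
  simp only [hsum] at hlim
  have h2 := hlim.const_mul (1 / 2 : ℂ)
  refine (h2.congr fun n => ?_).trans_eq ?_
  · ring
  · congr 1
    ring

end KMS

end

/-! ### The form of the error term -/

theorem mainTheorem4
    (a : ℝ → ℝ → ℂ) (α : ℝ≥0) (hα_pos : 0 < α) (hα_le : α ≤ 1)
    (ha_t : ∀ x ∈ Icc (0 : ℝ) 1, KMS.C1Holder α (fun t => a x t) 0 (2 * Real.pi))
    (ha_x : ∀ t ∈ Icc (0 : ℝ) (2 * Real.pi), KMS.C1Holder α (fun x => a x t) 0 1)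
    (hcoeff : ∀ k : ℤ, ContDiffOn ℝ 1 (KMS.coeff a k) (Icc 0 1))
    (hdecay : Summable fun k : ℤ =>
      |(k : ℝ)| ^ (1 + 1 / (α : ℝ)) * KMS.supNorm (KMS.coeff a k))
    (hdecay_deriv : Summable fun k : ℤ =>
      KMS.supNorm (derivWithin (KMS.coeff a k) (Icc 0 1)))
    (p : ℕ) :
    Summable (fun h : {h : Fin p → ℤ // ∑ j, h j = 0} => KMS.edgeTerm a h.1) ∧
    ∃ η : ℕ → ℂ, Tendsto η atTop (𝓝 0) ∧ ∀ n : ℕ,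
      (KMS.T a n ^ p).trace =
        ((n : ℂ) + 1) / (2 * Real.pi) *
            (∫ x in (0 : ℝ)..1, ∫ t in (0 : ℝ)..(2 * Real.pi), a x t ^ p)
          + 1 / (4 * Real.pi) * (∫ t in (0 : ℝ)..(2 * Real.pi), a 0 t ^ p)
          - 1 / (4 * Real.pi) * (∫ t in (0 : ℝ)..(2 * Real.pi), a 1 t ^ p)
          - (∑' h : {h : Fin p → ℤ // ∑ j, h j = 0}, KMS.edgeTerm a h.1)
          + (p : ℂ) * (KMS.tripleNorm a : ℂ) ^ (p - 1) * η n := by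
  have hw : Summable (KMS.weight a) :=
    (KMS.summable_one_add_abs_mul (fun k => KMS.supNorm_nonneg _)
      (le_add_of_nonneg_right (by positivity)) hdecay).add hdecay_deriv
  have ha : ∀ x ∈ Icc (0 : ℝ) 1, ContinuousOn (a x) (Icc 0 (2 * Real.pi)) :=
    fun x hx => (ha_t x hx).1.continuousOn
  refine ⟨KMS.summable_edgeTerm hcoeff hw p, ?_⟩
  have hlim := KMS.tendsto_trace_sub hcoeff hw ha p
  set I := ∫ x in (0 : ℝ)..1, ∫ t in (0 : ℝ)..(2 * Real.pi), a x t ^ p with hI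
  set I₀ := ∫ t in (0 : ℝ)..(2 * Real.pi), a 0 t ^ p with hI₀
  set I₁ := ∫ t in (0 : ℝ)..(2 * Real.pi), a 1 t ^ p with hI₁
  set S := ∑' h : {h : Fin p → ℤ // ∑ j, h j = 0}, KMS.edgeTerm a h.1 with hS
  set δ : ℕ → ℂ := fun n => (KMS.T a n ^ p).trace - ((n : ℂ) + 1) / (2 * Real.pi) * I -
    (1 / (4 * Real.pi) * I₀ - 1 / (4 * Real.pi) * I₁ - S) with hδ
  have hδ0 : Tendsto δ atTop (𝓝 0) := by
    have := hlim.sub_const (1 / (4 * Real.pi) * I₀ - 1 / (4 * Real.pi) * I₁ - S)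
    rwa [sub_self] at this
  have hpi : (Real.pi : ℂ) ≠ 0 := by exact_mod_cast Real.pi_ne_zero
  -- The witness `η` is the error `δ` divided by this prefactor, so `δ` must vanish identically
  -- whenever the prefactor does.
  have hdeg : (p : ℂ) * (KMS.tripleNorm a : ℂ) ^ (p - 1) = 0 → ∀ n, δ n = 0 := by
    intro hz n
    rcases mul_eq_zero.1 hz with hp | hp
    · have hp0 : p = 0 := by exact_mod_cast hp
      subst hp0
      have hS0 : S = 0 := by
        rw [hS]
        exact (tsum_congr fun h => by simp [KMS.edgeTerm, KMS.N]).trans tsum_zero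
      simp only [hδ, hS0, hI, hI₀, hI₁, pow_zero, Matrix.trace_one, Fintype.card_fin,
        intervalIntegral.integral_const, sub_zero, Complex.real_smul, Complex.ofReal_mul,
        Complex.ofReal_ofNat, mul_one, Complex.ofReal_one, one_mul]
      push_cast
      field_simp
      ring
    -- Here all Fourier coefficients vanish on `[0, 1]` and `p` is positive, so every term of the
    -- expansion is zero.
    · obtain ⟨ht, hp1⟩ := pow_eq_zero_iff'.1 hp
      have hp0 : p ≠ 0 := fun h => hp1 (by rw [h])
      have ht0 : KMS.tripleNorm a = 0 := by exact_mod_cast ht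
      have hsum0 : HasSum (fun k => KMS.supNorm (KMS.coeff a k)) 0 :=
        ht0 ▸ (show HasSum _ (KMS.tripleNorm a) from (KMS.summable_supNorm_coeff hw).hasSum)
      have hzero := (hasSum_zero_iff_of_nonneg fun k => KMS.supNorm_nonneg _).1 hsum0
      have hc0 : ∀ k, ∀ x ∈ Icc (0 : ℝ) 1, KMS.coeff a k x = 0 := fun k x hx => by
        have h1 := KMS.norm_le_supNorm (hcoeff k).continuousOn hx
        have h2 : KMS.supNorm (KMS.coeff a k) = 0 := congrFun hzero k
        rw [h2] at h1
        exact norm_le_zero_iff.1 h1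
      have hprod : ∀ (h : Fin p → ℤ), ∀ x ∈ Icc (0 : ℝ) 1, ∏ j, KMS.coeff a (h j) x = 0 :=
        fun h x hx => Finset.prod_eq_zero (Finset.mem_univ ⟨0, Nat.pos_of_ne_zero hp0⟩)
          (hc0 _ x hx)
      have hpow : ∀ x ∈ Icc (0 : ℝ) 1, ∫ t in (0 : ℝ)..(2 * Real.pi), a x t ^ p = 0 := by
        intro x hx
        have h1 := (KMS.hasSum_prod_coeff hcoeff hw ha p hx).tsum_eq
        rw [tsum_congr fun h : {h : Fin p → ℤ // ∑ j, h j = 0} => hprod h.1 x hx, tsum_zero] at h1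
        simpa [hpi] using h1.symm
      have hT : KMS.T a n = 0 := by
        ext i j
        refine hc0 _ _ ⟨by positivity, ?_⟩
        rw [div_le_one (by positivity)]
        have hi : ((i : ℕ) : ℝ) ≤ n := by exact_mod_cast Nat.lt_succ_iff.1 i.2
        have hj : ((j : ℕ) : ℝ) ≤ n := by exact_mod_cast Nat.lt_succ_iff.1 j.2
        linarith
      have hI0 : I = 0 := by
        rw [hI]
        refine intervalIntegral.integral_zero_ae (Eventually.of_forall fun x hx => ?_)
        rw [uIoc_of_le zero_le_one] at hx
        exact hpow x (Ioc_subset_Icc_self hx)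
      have hS0 : S = 0 := by
        rw [hS]
        refine (tsum_congr fun h => ?_).trans tsum_zero
        rw [KMS.edgeTerm, hprod h.1 0 (by simp), hprod h.1 1 (by simp), add_zero, mul_zero]
      simp only [hδ, hT, hI0, hI₀, hI₁, hS0, hpow 0 (by simp), hpow 1 (by simp), zero_pow hp0,
        Matrix.trace_zero]
      ring
  refine ⟨fun n => δ n / ((p : ℂ) * (KMS.tripleNorm a : ℂ) ^ (p - 1)), ?_, fun n => ?_⟩
  · simpa using hδ0.div_const ((p : ℂ) * (KMS.tripleNorm a : ℂ) ^ (p - 1))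
  · rw [mul_div_cancel_of_imp' fun hz => hdeg hz n]
    simp only [hδ]
    ring
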